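/- **Setting.** Let $(\mathsf B,\mathsf D,\rho,\nu)$ be a random pointed compact metric space endowed with a Borel probability measure, and let $(\mathsf B_n,\mathsf D_n,\rho_n,\nu_n)_{n\ge1}$ be i.i.d. copies of it. All blocks are realised as random compact subsets, containing a fixed point $u_0$ (the common root), of a complete separable metric space $(U,\delta)$ (for instance the Urysohn space, into which every random block can be embedded in this way), with the induced distance. Let $(\lambda_n)_{n\ge1}$ be positive real numbers and $(w_n)_{n\ge1}$ non-negative real numbers with $w_1>0$, and put $W_n=\sum_{k=1}^n w_k$. The scaled blocks are $\mathbf b_n=(\mathsf B_n,\lambda_n\mathsf D_n,\rho_n,w_n\nu_n)$. Set $\mathcal T_1=\mathbf b_1$. Given $\mathcal T_n$, choose $K_n\in\{1,\dots,n\}$ with $\mathbb P(K_n=k)=w_k/W_n$ and then a point $X_n$ of $\mathbf b_{K_n}$ with law $\nu_{K_n}$; conditionally on the sequence of blocks, the pairs $(K_n,X_n)_{n\ge1}$ are independent (here $X_n$ is viewed as a point of the block of index $K_n$). Obtain $\mathcal T_{n+1}$ by gluing the root of $\mathbf b_{n+1}$ to $X_n$. Concretely, $\mathcal T_n$ is a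 subset of the space of sequences $x=(x_n)_{n\ge1}$ in $U$ with $\sum_n\lambda_n\delta(x_n,u_0)<\infty$, with distance $\sum_n\lambda_n\delta(x_n,y_n)$: $\mathcal T_1=\{(x,u_0,u_0,\dots):x\in \mathsf B_1\}$, and a point $x$ of $\mathsf B_{n+1}$ corresponds to the sequence whose $(n+1)$-st coordinate is $x$ and whose other coordinates are those of $X_n$. Let $\mathcal T^*=\bigcup_n\mathcal T_n$, let $\mathcal T$ be its completion (its closure in this complete space), and let $\mathcal L=\mathcal T\setminus\mathcal T^*$. Let $\mathcal H=\mathsf D(\rho,X)$, where, conditionally on the block, $X$ has law $\nu$. For $\alpha>0$, $\beta\in\mathbb R$ and $\varepsilon>0$ let $G^\varepsilon=\{k\ge1: w_k\ge k^{-\beta-\varepsilon},\ \lambda_k\ge k^{-\alpha-\varepsilon}\}$. All $o(1)$ below are deterministic sequences tending to $0$ as $n\to\infty$, and the relations involving them are required for all large $n$. * Hypothesis $\bigcirc_{\alpha,\beta}$: $\alpha>0$, $\beta<1$, $\lambda_n\le n^{-\alpha+o(1)}$, $w_n\le n^{-\beta+o(1)}$, $W_n=n^{1-\beta+o(1)}$,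 and for all $\varepsilon>0$, $\displaystyle\liminf_{n\to\infty}\frac{\sum_{k=1}^n w_k\mathbf 1_{\{k\in G^\varepsilon\}}}{\sum_{k=1}^n w_k}>0$. * Hypothesis $\square_{\alpha,1}$: $\alpha>0$, $\beta=1$, $\lambda_n\le n^{-\alpha+o(1)}$, $w_n\le n^{-1+o(1)}$, and for all $\varepsilon>0$, $\displaystyle\frac1{\log\log\log N}\sum_{N\le k\le N^{1+\varepsilon}}\frac{w_k}{W_k}\mathbf 1_{\{k\in G^\varepsilon\}}\to+\infty$ as $N\to\infty$. **Proposition.** Suppose that Hypothesis $\bigcirc_{\alpha,\beta}$ or Hypothesis $\square_{\alpha,1}$ is satisfied, that $\mathbb E[\mathcal H^2]<\infty$, and that $\mathbb P(\mathcal H>0)>0$. Then, almost surely, the Hausdorff dimension of $\mathcal L$ satisfies $$\dim_{\mathrm H}(\mathcal L)\ \ge\ \frac1\alpha .$$ -/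

import Mathlib

open Set Filter Topology MeasureTheory ProbabilityTheory
open scoped ENNReal

/-! ### The ambient space `ℓ¹(U, u₀)` -/

/-- Sequences `(x n)` (`n ≥ 1`) of points of the pointed metric space `(U, u₀)` with
`∑ n, lam n * dist (x n) u₀ < ∞`.  The `n`-th coordinate lives in the dilated copy
`(U, lam n • dist)` of `U`, into which the `n`-th scaled block is embedded.
All sequences of the development are indexed from `1`; the index `0` is unused, and the
coordinate `0` is frozen at `u₀`. -/
def EllOne {U : Type*} [MetricSpace U] (u₀ : U) (lam : ℕ → ℝ)
    (_hlam : ∀ n, 1 ≤ n → 0 < lam n) : Type _ :=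
  {x : ℕ → U // x 0 = u₀ ∧ Summable fun n => lam n * dist (x n) u₀}

namespace EllOne

variable {U : Type*} [MetricSpace U] {u₀ : U} {lam : ℕ → ℝ} {hlam : ∀ n, 1 ≤ n → 0 < lam n}

/-- The `n`-th coordinate. -/
def coord (x : EllOne u₀ lam hlam) (n : ℕ) : U := x.1 n

theorem coord_zero (x : EllOne u₀ lam hlam) : x.coord 0 = u₀ := x.2.1

theorem ext_coord {x y : EllOne u₀ lam hlam} (h : ∀ n, x.coord n = y.coord n) : x = y :=
  Subtype.ext (funext h)

theorem term_nonneg (x y : EllOne u₀ lam hlam) (n : ℕ) :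
    0 ≤ lam n * dist (x.coord n) (y.coord n) := by
  rcases Nat.eq_zero_or_pos n with rfl | hn
  · simp [coord_zero]
  · exact mul_nonneg (hlam n hn).le dist_nonneg

theorem term_triangle (x y z : EllOne u₀ lam hlam) (n : ℕ) :
    lam n * dist (x.coord n) (z.coord n) ≤
      lam n * dist (x.coord n) (y.coord n) + lam n * dist (y.coord n) (z.coord n) := by
  rcases Nat.eq_zero_or_pos n with rfl | hn
  · simp [coord_zero]
  · rw [← mul_add]
    exact mul_le_mul_of_nonneg_left (dist_triangle _ _ _) (hlam n hn).le

theorem summable_dist (x y : EllOne u₀ lam hlam) :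
    Summable fun n => lam n * dist (x.coord n) (y.coord n) := by
  refine Summable.of_nonneg_of_le (term_nonneg x y) (fun n => ?_) (x.2.2.add y.2.2)
  rcases Nat.eq_zero_or_pos n with rfl | hn
  · simp [coord_zero, x.2.1, y.2.1]
  · rw [← mul_add]
    exact mul_le_mul_of_nonneg_left (dist_triangle_right _ _ _) (hlam n hn).le

/-- The distance `∑ n, lam n * dist (x n) (y n)`. -/
noncomputable instance : MetricSpace (EllOne u₀ lam hlam) where
  dist x y := ∑' n, lam n * dist (x.coord n) (y.coord n)
  dist_self x := by simp
  dist_comm x y := by simp [dist_comm]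
  dist_triangle x y z := by
    rw [← (summable_dist x y).tsum_add (summable_dist y z)]
    exact (summable_dist x z).tsum_le_tsum (term_triangle x y z)
      ((summable_dist x y).add (summable_dist y z))
  eq_of_dist_eq_zero {x y} h := by
    have h0 := (hasSum_zero_iff_of_nonneg (term_nonneg x y)).1 (h ▸ (summable_dist x y).hasSum)
    refine ext_coord fun n => ?_
    rcases Nat.eq_zero_or_pos n with rfl | hn
    · rw [coord_zero, coord_zero]
    · have := congrFun h0 n
      simpa [(hlam n hn).ne'] using this

theorem dist_def (x y : EllOne u₀ lam hlam) :
    dist x y = ∑' n, lam n * dist (x.coord n) (y.coord n) := rfl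

theorem term_le_dist (x y : EllOne u₀ lam hlam) (n : ℕ) :
    lam n * dist (x.coord n) (y.coord n) ≤ dist x y :=
  (summable_dist x y).le_tsum n (fun i _ => term_nonneg x y i)

/-- The space is complete, so that closures in it are completions. -/
instance [CompleteSpace U] : CompleteSpace (EllOne u₀ lam hlam) := by
  refine Metric.complete_of_cauchySeq_tendsto fun u hu => ?_
  have hc : ∀ n, ∃ y, Tendsto (fun k => (u k).coord n) atTop (𝓝 y) := by
    intro n
    rcases Nat.eq_zero_or_pos n with rfl | hn
    · exact ⟨u₀, by simp [coord_zero]⟩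
    · refine cauchySeq_tendsto_of_complete (Metric.cauchySeq_iff.2 fun ε hε => ?_)
      obtain ⟨N, hN⟩ := Metric.cauchySeq_iff.1 hu (lam n * ε) (mul_pos (hlam n hn) hε)
      refine ⟨N, fun p hp q hq => ?_⟩
      have := (term_le_dist (u p) (u q) n).trans_lt (hN p hp q hq)
      exact lt_of_mul_lt_mul_left this (hlam n hn).le
  choose y hy using hc
  have hy0 : y 0 = u₀ := by
    refine tendsto_nhds_unique (hy 0) ?_
    simp [coord_zero]
  have key : ∀ ε > 0, ∃ N, ∀ p ≥ N, ∀ s : ℕ,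
      ∑ n ∈ Finset.range s, lam n * dist ((u p).coord n) (y n) ≤ ε := by
    intro ε hε
    obtain ⟨N, hN⟩ := Metric.cauchySeq_iff.1 hu ε hε
    refine ⟨N, fun p hp s => ?_⟩
    have ht : Tendsto (fun q => ∑ n ∈ Finset.range s,
        lam n * dist ((u p).coord n) ((u q).coord n)) atTop
        (𝓝 (∑ n ∈ Finset.range s, lam n * dist ((u p).coord n) (y n))) :=
      tendsto_finsetSum _ fun n _ => (tendsto_const_nhds.dist (hy n)).const_mul _
    refine le_of_tendsto ht (eventually_atTop.2 ⟨N, fun q hq => ?_⟩)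
    exact ((summable_dist (u p) (u q)).sum_le_tsum _
      (fun n _ => term_nonneg (u p) (u q) n)).trans (hN p hp q hq).le
  have hnn : ∀ p n, 0 ≤ lam n * dist ((u p).coord n) (y n) := by
    intro p n
    rcases Nat.eq_zero_or_pos n with rfl | hn
    · simp [coord_zero, hy0]
    · exact mul_nonneg (hlam n hn).le dist_nonneg
  have hysum : Summable fun n => lam n * dist (y n) u₀ := by
    obtain ⟨N, hN⟩ := key 1 one_pos
    have h1 : Summable fun n => lam n * dist ((u N).coord n) (y n) :=
      summable_of_sum_range_le (hnn N) (hN N le_rfl)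
    refine Summable.of_nonneg_of_le (fun n => ?_) (fun n => ?_) (h1.add (u N).2.2)
    · rcases Nat.eq_zero_or_pos n with rfl | hn
      · simp [hy0]
      · exact mul_nonneg (hlam n hn).le dist_nonneg
    · rcases Nat.eq_zero_or_pos n with rfl | hn
      · simp [coord_zero, hy0, (u N).2.1]
      · rw [← mul_add]
        exact mul_le_mul_of_nonneg_left (dist_triangle_left _ _ _) (hlam n hn).le
  refine ⟨⟨y, hy0, hysum⟩, Metric.tendsto_atTop.2 fun ε hε => ?_⟩
  obtain ⟨N, hN⟩ := key (ε / 2) (half_pos hε)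
  refine ⟨N, fun p hp => ?_⟩
  exact (Real.tsum_le_of_sum_range_le (hnn p) (hN p hp)).trans_lt (half_lt_self hε)

/-- The constant sequence `u₀`. -/
def base (u₀ : U) (lam : ℕ → ℝ) (hlam : ∀ n, 1 ≤ n → 0 < lam n) : EllOne u₀ lam hlam :=
  ⟨fun _ => u₀, rfl, by simp⟩

/-- The sequence `p` with its `k`-th coordinate replaced by `x` (for `k ≥ 1`). -/
def update (p : EllOne u₀ lam hlam) (k : ℕ) (hk : 1 ≤ k) (x : U) : EllOne u₀ lam hlam :=
  ⟨Function.update p.coord k x, by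
    rw [Function.update_of_ne (by omega)]; exact p.coord_zero, by
    refine (summable_congr_cofinite ?_).1 p.2.2
    filter_upwards [(Set.finite_singleton k).compl_mem_cofinite] with n hn
    rw [Function.update_of_ne (by simpa using hn)]; rfl⟩

end EllOne

/-! ### Blocks -/

/-- A block, embedded in `U`: a compact set containing the root `u₀`, with the distance
inherited from `U`, and a Borel probability measure carried by it. -/
structure Block {U : Type*} [MetricSpace U] [MeasurableSpace U] (u₀ : U) where
  carrier : TopologicalSpace.NonemptyCompacts U
  root_mem : u₀ ∈ carrier
  ν : ProbabilityMeasure U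
  ν_compl : (ν : Measure U) (carrier : Set U)ᶜ = 0

/-- The σ-algebra generated by the compact set (Borel σ-algebra of the Hausdorff distance) and by
the measure (generated by the evaluations `ν ↦ ν A`, i.e. the Borel σ-algebra of weak convergence).
For separable `U` it is the Borel σ-algebra of the Hausdorff–Prokhorov distance. -/
instance {U : Type*} [MetricSpace U] [MeasurableSpace U] (u₀ : U) : MeasurableSpace (Block u₀) :=
  MeasurableSpace.comap Block.carrier (borel (TopologicalSpace.NonemptyCompacts U)) ⊔
    MeasurableSpace.comap Block.ν inferInstance

/-! ### The gluing construction, for a given realisation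

`b k` is the `k`-th unscaled block; block `k + 1` is grafted onto block `K k`, at its point `Z k`. -/

section Gluing

variable {U : Type*} [MetricSpace U] {u₀ : U} {lam : ℕ → ℝ} {hlam : ∀ n, 1 ≤ n → 0 < lam n}

/-- The point `X n` at which the root of block `n + 1` is glued.  For `n = 0` it is the constant
sequence `u₀`, the root of the first block.  A point `x` of block `k` is the sequence obtained from
`X (k - 1)` (the root of block `k`) by putting `x` at the coordinate `k`; so for `n ≥ 1`, `X n` is
the point `Z n` of block `K n`.  (For `n ≥ 1` the last branch is almost surely not taken, since
`1 ≤ K n ≤ n`.) -/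
noncomputable def gluePoint (u₀ : U) (lam : ℕ → ℝ) (hlam : ∀ n, 1 ≤ n → 0 < lam n)
    (K : ℕ → ℕ) (Z : ℕ → U) (n : ℕ) : EllOne u₀ lam hlam :=
  if h : 1 ≤ K n ∧ K n ≤ n then
    (gluePoint u₀ lam hlam K Z (K n - 1)).update (K n) h.1 (Z n)
  else EllOne.base u₀ lam hlam
termination_by n
decreasing_by omega

variable [MeasurableSpace U]

/-- The `k`-th scaled block, `k ≥ 1`, as a subset of the glued structure. -/
noncomputable def gluedBlock (lam : ℕ → ℝ) (hlam : ∀ n, 1 ≤ n → 0 < lam n)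
    (b : ℕ → Block u₀) (K : ℕ → ℕ) (Z : ℕ → U) (k : ℕ) (hk : 1 ≤ k) :
    Set (EllOne u₀ lam hlam) :=
  (fun x => (gluePoint u₀ lam hlam K Z (k - 1)).update k hk x) '' ((b k).carrier : Set U)

/-- `𝒯ₙ`, the union of the first `n` glued blocks. -/
noncomputable def glued (lam : ℕ → ℝ) (hlam : ∀ n, 1 ≤ n → 0 < lam n)
    (b : ℕ → Block u₀) (K : ℕ → ℕ) (Z : ℕ → U) (n : ℕ) : Set (EllOne u₀ lam hlam) :=
  ⋃ (k : ℕ) (hk : 1 ≤ k) (_ : k ≤ n), gluedBlock lam hlam b K Z k hk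

/-- The skeleton `𝒯* = ⋃ₙ 𝒯ₙ`. -/
noncomputable def skeleton (lam : ℕ → ℝ) (hlam : ∀ n, 1 ≤ n → 0 < lam n)
    (b : ℕ → Block u₀) (K : ℕ → ℕ) (Z : ℕ → U) : Set (EllOne u₀ lam hlam) :=
  ⋃ n : ℕ, glued lam hlam b K Z n

/-- `𝒯`, the closure (equivalently, the completion) of `𝒯*`. -/
noncomputable def gluedLimit (lam : ℕ → ℝ) (hlam : ∀ n, 1 ≤ n → 0 < lam n)
    (b : ℕ → Block u₀) (K : ℕ → ℕ) (Z : ℕ → U) : Set (EllOne u₀ lam hlam) :=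
  closure (skeleton lam hlam b K Z)

/-- The set of leaves `ℒ = 𝒯 \ 𝒯*`. -/
noncomputable def leaves (lam : ℕ → ℝ) (hlam : ∀ n, 1 ≤ n → 0 < lam n)
    (b : ℕ → Block u₀) (K : ℕ → ℕ) (Z : ℕ → U) : Set (EllOne u₀ lam hlam) :=
  gluedLimit lam hlam b K Z \ skeleton lam hlam b K Z

end Gluing

/-! ### The random construction -/

/-- `W n = ∑_{k=1}^n w k`. -/
noncomputable def totalWeight (w : ℕ → ℝ) (n : ℕ) : ℝ := ∑ k ∈ Finset.Icc 1 n, w k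

section Random

variable {U : Type*} [MetricSpace U] [MeasurableSpace U] {u₀ : U}

/-- The law `∑_{k=1}^n (w k / W n) • δ_k ⊗ ν_k` on `ℕ × U` of `(K n, Z n)` given the blocks:
a block among the first `n`, chosen proportionally to the weights, and a point of it. -/
noncomputable def graftLaw (w : ℕ → ℝ) (b : ℕ → Block u₀) (n : ℕ) : Measure (ℕ × U) :=
  ∑ k ∈ Finset.Icc 1 n,
    ENNReal.ofReal (w k / totalWeight w n) • (Measure.dirac k).prod ((b k).ν : Measure U)

variable {Ω : Type*} [MeasurableSpace Ω]

/-- The σ-algebra generated by all the blocks and by `(K m, Z m)` for `1 ≤ m < n`. -/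
@[reducible] def pastSigma (B : ℕ → Ω → Block u₀) (K : ℕ → Ω → ℕ) (Z : ℕ → Ω → U) (n : ℕ) :
    MeasurableSpace Ω :=
  (⨆ (j : ℕ) (_ : 1 ≤ j), MeasurableSpace.comap (B j) inferInstance) ⊔
    (⨆ (m : ℕ) (_ : 1 ≤ m ∧ m < n),
      MeasurableSpace.comap (fun ω => (K m ω, Z m ω)) inferInstance)

/-- The law of the gluing process: the blocks `B 1, B 2, …` are i.i.d., and conditionally on them
the pairs `(K n, Z n)`, `n ≥ 1`, are independent with respective laws `graftLaw`. -/
structure IsRandomGluing (P : Measure Ω) (w : ℕ → ℝ) (B : ℕ → Ω → Block u₀)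
    (K : ℕ → Ω → ℕ) (Z : ℕ → Ω → U) : Prop where
  measurable_block : ∀ n, 1 ≤ n → Measurable (B n)
  indep_block : iIndepFun (fun n => B (n + 1)) P
  identDistrib_block : ∀ n, 1 ≤ n → IdentDistrib (B n) (B 1) P P
  measurable_graft : ∀ n, 1 ≤ n → Measurable fun ω => (K n ω, Z n ω)
  graft_law : ∀ n, 1 ≤ n → ∀ A : Set (ℕ × U), MeasurableSet A →
    P⟦(fun ω => (K n ω, Z n ω)) ⁻¹' A | pastSigma B K Z n⟧
      =ᵐ[P] fun ω => (graftLaw w (fun k => B k ω) n).real A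

/-- The law of the height `ℋ = dist u₀ X` of a point `X` of the random block `B₁` which, given
`B₁`, has the distribution of the probability measure of `B₁`. -/
noncomputable def heightLaw (P : Measure Ω) (B₁ : Ω → Block u₀) : Measure ℝ :=
  (P.bind fun ω => ((B₁ ω).ν : Measure U)).map fun x => dist u₀ x

end Random

/-! ### Hypotheses on the scaling factors and the weights -/

/-- `a n ≤ n ^ (c + o(1))`. -/
def PowUpper (a : ℕ → ℝ) (c : ℝ) : Prop :=
  ∃ e : ℕ → ℝ, Tendsto e atTop (𝓝 0) ∧ ∀ᶠ n : ℕ in atTop, a n ≤ (n : ℝ) ^ (c + e n)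

/-- `a n = n ^ (c + o(1))`. -/
def PowEq (a : ℕ → ℝ) (c : ℝ) : Prop :=
  ∃ e : ℕ → ℝ, Tendsto e atTop (𝓝 0) ∧ ∀ᶠ n : ℕ in atTop, a n = (n : ℝ) ^ (c + e n)

/-- `G^ε = {k ≥ 1 | w k ≥ k ^ (-β - ε), lam k ≥ k ^ (-α - ε)}`. -/
def goodSet (lam w : ℕ → ℝ) (α β ε : ℝ) : Set ℕ :=
  {k | 1 ≤ k ∧ (k : ℝ) ^ (-β - ε) ≤ w k ∧ (k : ℝ) ^ (-α - ε) ≤ lam k}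

/-- The hypothesis `◯_{α,β}`. -/
structure HypCircle (lam w : ℕ → ℝ) (α β : ℝ) : Prop where
  α_pos : 0 < α
  β_lt : β < 1
  lam_le : PowUpper lam (-α)
  w_le : PowUpper w (-β)
  W_eq : PowEq (totalWeight w) (1 - β)
  liminf_pos : ∀ ε : ℝ, 0 < ε →
    0 < liminf (fun n : ℕ => (∑ k ∈ Finset.Icc 1 n, (goodSet lam w α β ε).indicator w k) /
      ∑ k ∈ Finset.Icc 1 n, w k) atTop

/-- The hypothesis `□_{α,1}`. -/
structure HypSquare (lam w : ℕ → ℝ) (α : ℝ) : Prop where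
  α_pos : 0 < α
  lam_le : PowUpper lam (-α)
  w_le : PowUpper w (-1)
  tendsto_sum : ∀ ε : ℝ, 0 < ε →
    Tendsto (fun N : ℕ => 1 / Real.log (Real.log (Real.log N)) *
      ∑ k ∈ Finset.Icc N ⌊(N : ℝ) ^ (1 + ε)⌋₊,
        (goodSet lam w α 1 ε).indicator (fun k => w k / totalWeight w k) k) atTop atTop

/-! Write q_k = w_k / W_k (`stepProb`). The leaves carry a measure to which a mass distribution
principle applies: every subsequential weak limit μ of the laws `leafLaw` of a weighted random point
of 𝒯ₙ, along which an energy stays bounded.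

Averaged over the grafting but given the blocks, the coordinates of a random point of 𝒯ₙ are
independent: for k ≤ n the k-th is trivial (equal to u₀) with probability 1 - q_k, and otherwise has
law ν_k (`IsRandomGluing.lintegral_prod_coord`). Three facts follow.

Crossing. At the scales t_j = exp((1+ε)^j), the indices k between about t_j and t_{j+2} with λ_k ≥
k^(-α-ε) have ∑ q_k at least a large multiple of log log log t_j, which is of order log j. Hence the
probability that the random point crosses none of these blocks at unscaled height at least r is
O(j⁻²) (`GrowthBounds.summable_prod`, `IsRandomGluing.lintegral_close_le`). By Borel–Cantelli,
μ-almost every point makes such a crossing at all large scales.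

Mass. The subtree above block k, the set of points with nontrivial k-th coordinate, has a mass whose
second moment is at most q_k² + q_k ∑_{i>k} q_i² = k^(-2+o(1))
(`IsRandomGluing.lintegral_coord_ne_sq_le`). A second Borel–Cantelli argument, under μ, bounds this
mass by k^(-(1-ε)) for all large k crossed by a typical point (`ae_eventually_measure_le`).

Summability. ∑ λ_k q_k < ∞ and the mean height is finite, so μ-almost every sequence lies in ℓ¹.

If x crosses block k at height at least r, a point with trivial k-th coordinate is at distance at
least λ_k r from x. Thus a set containing x of diameter less than about t_j^(-α) stays in a subtree
of mass about t_j^(-1), which gives dimension 1/α up to a loss vanishing with ε (`le_dimH_leaves`,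
`dimBound_le_dimH_leaves`).

The existence of μ needs no almost sure convergence. The three quantities form `leafEnergy`, whose
expectation is bounded uniformly in n. By Fatou its liminf is almost surely finite, so for fixed ω a
subsequence has bounded energy. All the laws live on the compact product of the blocks, so a further
subsequence converges weakly, and the energy bounds pass to the limit because they involve only open
sets and nonnegative continuous functions. -/

/-! ### Consequences of the hypotheses on the scaling factors and the weights -/

/-- The probability `w k / W k` that a random point of `𝒯ₖ` lies in the `k`-th block. -/
noncomputable def stepProb (w : ℕ → ℝ) (k : ℕ) : ℝ := w k / totalWeight w k

section Weights

variable {lam w : ℕ → ℝ}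

theorem totalWeight_zero (w : ℕ → ℝ) : totalWeight w 0 = 0 := by simp [totalWeight]

theorem totalWeight_succ (w : ℕ → ℝ) (n : ℕ) :
    totalWeight w (n + 1) = totalWeight w n + w (n + 1) := by
  simp [totalWeight, Finset.sum_Icc_succ_top]

theorem stepProb_zero (w : ℕ → ℝ) : stepProb w 0 = 0 := by
  simp [stepProb, totalWeight_zero]

theorem le_totalWeight (hw : ∀ n, 1 ≤ n → 0 ≤ w n) {n k : ℕ} (hk : 1 ≤ k) (hn : k ≤ n) :
    w k ≤ totalWeight w n :=
  Finset.single_le_sum (f := w) (fun i hi => hw i (Finset.mem_Icc.1 hi).1)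
    (Finset.mem_Icc.2 ⟨hk, hn⟩)

theorem totalWeight_pos (hw1 : 0 < w 1) (hw : ∀ n, 1 ≤ n → 0 ≤ w n) {n : ℕ} (hn : 1 ≤ n) :
    0 < totalWeight w n :=
  hw1.trans_le (le_totalWeight hw le_rfl hn)

theorem totalWeight_nonneg (hw : ∀ n, 1 ≤ n → 0 ≤ w n) (n : ℕ) : 0 ≤ totalWeight w n :=
  Finset.sum_nonneg fun i hi => hw i (Finset.mem_Icc.1 hi).1

theorem stepProb_nonneg (hw : ∀ n, 1 ≤ n → 0 ≤ w n) (k : ℕ) : 0 ≤ stepProb w k := by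
  rcases Nat.eq_zero_or_pos k with rfl | hk
  · simp [stepProb_zero]
  · exact div_nonneg (hw k hk) (totalWeight_nonneg hw k)

theorem stepProb_le_one (hw : ∀ n, 1 ≤ n → 0 ≤ w n) (k : ℕ) : stepProb w k ≤ 1 := by
  rcases Nat.eq_zero_or_pos k with rfl | hk
  · simp [stepProb_zero]
  · exact div_le_one_of_le₀ (le_totalWeight hw hk le_rfl) (totalWeight_nonneg hw k)

theorem PowUpper.eventually_le {a : ℕ → ℝ} {c : ℝ} (h : PowUpper a c) {δ : ℝ} (hδ : 0 < δ) :
    ∀ᶠ n : ℕ in atTop, a n ≤ (n : ℝ) ^ (c + δ) := by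
  obtain ⟨e, he, h⟩ := h
  filter_upwards [h, he.eventually_lt_const hδ, eventually_ge_atTop 1] with n h1 h2 h3
  exact h1.trans (Real.rpow_le_rpow_of_exponent_le (by exact_mod_cast h3) (by linarith))

/-- The properties of the scaling factors and of the weights common to the two regimes. -/
structure GrowthBounds (lam w : ℕ → ℝ) (α : ℝ) : Prop where
  α_pos : 0 < α
  lam_le : ∀ δ : ℝ, 0 < δ → ∀ᶠ n : ℕ in atTop, lam n ≤ (n : ℝ) ^ (-α + δ)
  stepProb_le : ∀ δ : ℝ, 0 < δ → ∀ᶠ n : ℕ in atTop, stepProb w n ≤ (n : ℝ) ^ (-1 + δ)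
  le_sum : ∀ ε : ℝ, 0 < ε → ∀ A : ℝ, ∀ᶠ N : ℕ in atTop,
    A * Real.log (Real.log (Real.log N)) ≤ ∑ k ∈ (Finset.Icc N ⌊(N : ℝ) ^ (1 + ε)⌋₊).filter
      fun k : ℕ => (k : ℝ) ^ (-α - ε) ≤ lam k, stepProb w k

theorem tendsto_log_natCast : Tendsto (fun N : ℕ => Real.log N) atTop atTop :=
  Real.tendsto_log_atTop.comp tendsto_natCast_atTop_atTop

theorem sum_indicator_goodSet_le {α β ε : ℝ} (hw : ∀ n, 1 ≤ n → 0 ≤ w n) (s : Finset ℕ) :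
    ∑ k ∈ s, (goodSet lam w α β ε).indicator (fun k => w k / totalWeight w k) k ≤
      ∑ k ∈ s.filter fun k : ℕ => (k : ℝ) ^ (-α - ε) ≤ lam k, stepProb w k := by
  classical
  rw [Finset.sum_filter]
  refine Finset.sum_le_sum fun k _ => ?_
  by_cases hk : k ∈ goodSet lam w α β ε
  · rw [indicator_of_mem hk, if_pos hk.2.2]; rfl
  · rw [indicator_of_notMem hk]
    split_ifs
    exacts [stepProb_nonneg hw k, le_rfl]

/-- Since W_n ≥ w_1, dividing by W_n costs at most a constant, absorbed by n^(δ/2). The bound on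
sums is the last hypothesis of `HypSquare`, with the weight condition of `goodSet` dropped. -/
theorem HypSquare.growthBounds {α : ℝ} (hw1 : 0 < w 1) (hw : ∀ n, 1 ≤ n → 0 ≤ w n)
    (h : HypSquare lam w α) : GrowthBounds lam w α where
  α_pos := h.α_pos
  lam_le δ hδ := h.lam_le.eventually_le hδ
  stepProb_le δ hδ := by
    have ht : Tendsto (fun n : ℕ => (n : ℝ) ^ (δ / 2)) atTop atTop :=
      (tendsto_rpow_atTop (half_pos hδ)).comp tendsto_natCast_atTop_atTop
    filter_upwards [h.w_le.eventually_le (half_pos hδ), ht.eventually_ge_atTop (w 1)⁻¹,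
      eventually_ge_atTop 1] with n h1 h2 h3
    have hn : (0 : ℝ) < n := by exact_mod_cast h3
    calc stepProb w n ≤ w n / w 1 :=
          div_le_div_of_nonneg_left (hw n h3) hw1 (le_totalWeight hw le_rfl h3)
      _ ≤ (n : ℝ) ^ (-1 + δ / 2) * (n : ℝ) ^ (δ / 2) := by
          rw [div_eq_mul_inv]; gcongr
      _ = (n : ℝ) ^ (-1 + δ) := by rw [← Real.rpow_add hn]; ring_nf
  le_sum ε hε A := by
    have hL : Tendsto (fun N : ℕ => Real.log (Real.log (Real.log N))) atTop atTop :=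
      Real.tendsto_log_atTop.comp (Real.tendsto_log_atTop.comp tendsto_log_natCast)
    filter_upwards [(h.tendsto_sum ε hε).eventually_ge_atTop A, hL.eventually_gt_atTop 0]
      with N h1 h2
    rw [one_div, inv_mul_eq_div, le_div_iff₀ h2] at h1
    exact h1.trans (sum_indicator_goodSet_le hw _)

/-- Summation by parts: a set of indices carrying a proportion at least `c` of the weight of
`{1, …, n}`, for `n ≥ N`, carries about the same proportion of `∑ w k / W k`. -/
theorem le_sum_div_totalWeight (hw1 : 0 < w 1) (hw : ∀ n, 1 ≤ n → 0 ≤ w n) {a : ℕ → ℝ} {c : ℝ}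
    (ha : ∀ k, 1 ≤ k → a k ≤ w k) {N : ℕ} (hN : 1 ≤ N)
    (h : ∀ n, N ≤ n → c * totalWeight w n ≤ ∑ k ∈ Finset.Icc 1 n, a k)
    {M : ℕ} (hM : N ≤ M) :
    (∑ k ∈ Finset.Icc 1 M, a k) / totalWeight w M - 1 + c * ∑ k ∈ Finset.Ioc N M, stepProb w k ≤
      ∑ k ∈ Finset.Ioc N M, a k / totalWeight w k := by
  induction M, hM using Nat.le_induction with
  | base =>
    simp only [Finset.Ioc_self, Finset.sum_empty, mul_zero, add_zero, sub_nonpos]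
    refine div_le_one_of_le₀ ?_ (totalWeight_nonneg hw N)
    exact Finset.sum_le_sum fun k hk => ha k (Finset.mem_Icc.1 hk).1
  | succ M hM ih =>
    rw [Finset.sum_Ioc_succ_top (by omega), Finset.sum_Ioc_succ_top (by omega)]
    have hM0 : 0 < totalWeight w M := totalWeight_pos hw1 hw (by omega)
    have hM1 : 0 < totalWeight w (M + 1) := totalWeight_pos hw1 hw (by omega)
    have hs : ∑ k ∈ Finset.Icc 1 (M + 1), a k = (∑ k ∈ Finset.Icc 1 M, a k) + a (M + 1) :=
      Finset.sum_Icc_succ_top (by omega) _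
    set S := ∑ k ∈ Finset.Icc 1 M, a k
    have h1 : c ≤ S / totalWeight w M := (le_div_iff₀ hM0).2 (h M hM)
    have h2 : S / totalWeight w (M + 1) = S / totalWeight w M * (1 - stepProb w (M + 1)) := by
      have : totalWeight w M = totalWeight w (M + 1) - w (M + 1) := by
        rw [totalWeight_succ]; ring
      rw [stepProb, one_sub_div hM1.ne', ← this]
      field_simp
    rw [hs, add_div, h2]
    -- From M to M + 1 the ratio S / W gains a (M + 1) / W (M + 1) and loses q (M + 1) times its old
    -- value, which is at least c.
    nlinarith [mul_le_mul_of_nonneg_right h1 (stepProb_nonneg hw (M + 1))]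

/-- One step adds log(1 + w / W_M) ≤ w / W_M = q / (1 - q), with w = w (M + 1) and q = q (M + 1),
and this is at most 2q when q ≤ 1/2. -/
theorem log_totalWeight_sub_le (hw1 : 0 < w 1) (hw : ∀ n, 1 ≤ n → 0 ≤ w n) {N : ℕ} (hN : 1 ≤ N)
    (h : ∀ n, N ≤ n → stepProb w n ≤ 1 / 2) {M : ℕ} (hM : N ≤ M) :
    Real.log (totalWeight w M) - Real.log (totalWeight w N) ≤
      2 * ∑ k ∈ Finset.Ioc N M, stepProb w k := by
  induction M, hM using Nat.le_induction with
  | base => simp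
  | succ M hM ih =>
    rw [Finset.sum_Ioc_succ_top (by omega)]
    have hM0 : 0 < totalWeight w M := totalWeight_pos hw1 hw (by omega)
    have hM1 : 0 < totalWeight w (M + 1) := totalWeight_pos hw1 hw (by omega)
    have h1 : stepProb w (M + 1) * totalWeight w (M + 1) = w (M + 1) := by
      rw [stepProb, div_mul_cancel₀ _ hM1.ne']
    have h2 := h (M + 1) (by omega)
    have h3 := stepProb_nonneg hw (M + 1)
    have h4 : totalWeight w (M + 1) = totalWeight w M + w (M + 1) := totalWeight_succ w M
    have h5 : Real.log (totalWeight w (M + 1)) - Real.log (totalWeight w M) ≤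
        totalWeight w (M + 1) / totalWeight w M - 1 := by
      rw [← Real.log_div hM1.ne' hM0.ne']
      exact Real.log_le_sub_one_of_pos (div_pos hM1 hM0)
    have h6 : totalWeight w (M + 1) / totalWeight w M - 1 ≤ 2 * stepProb w (M + 1) := by
      rw [div_sub_one hM0.ne', div_le_iff₀ hM0]
      nlinarith [mul_le_mul_of_nonneg_right h2 (mul_nonneg h3 hM1.le)]
    linarith

/-- Between N and M ≈ N^(1+ε), log W grows by a constant times log N because W is a power up to
n^(o(1)). Hence ∑ q_k over this range is at least of order log N, the positive liminf gives the good
indices a fixed share of it, and log N dominates the triple logarithm. -/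
theorem HypCircle.growthBounds {α β : ℝ} (hw1 : 0 < w 1) (hw : ∀ n, 1 ≤ n → 0 ≤ w n)
    (h : HypCircle lam w α β) : GrowthBounds lam w α := by
  obtain ⟨e, he, hW⟩ := h.W_eq
  have hq : ∀ δ : ℝ, 0 < δ → ∀ᶠ n : ℕ in atTop, stepProb w n ≤ (n : ℝ) ^ (-1 + δ) := by
    intro δ hδ
    filter_upwards [h.w_le.eventually_le (half_pos hδ), hW,
      he.eventually_const_lt (show -(δ / 2) < 0 by linarith), eventually_ge_atTop 1]
      with n h1 h2 h3 h4
    have hn : (1 : ℝ) ≤ n := by exact_mod_cast h4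
    have hn0 : (0 : ℝ) < n := by linarith
    rw [stepProb, div_le_iff₀ (totalWeight_pos hw1 hw h4), h2, ← Real.rpow_add hn0]
    exact h1.trans (Real.rpow_le_rpow_of_exponent_le hn (by linarith))
  refine ⟨h.α_pos, fun δ hδ => h.lam_le.eventually_le hδ, hq, fun ε hε A => ?_⟩
  obtain ⟨c, hc, hlim⟩ := exists_between (h.liminf_pos ε hε)
  have hev := eventually_lt_of_lt_liminf hlim ⟨0, eventually_map.2 (Eventually.of_forall fun n =>
    div_nonneg (Finset.sum_nonneg fun k hk => indicator_nonneg (fun i hi => hw i hi.1) k)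
      (totalWeight_nonneg hw n))⟩
  have hβ : 0 < 1 - β := by linarith [h.β_lt]
  -- Tolerance on the exponent of W. It makes (1 - β - δ)(1 + ε/2) - (1 - β + δ) at least (1 -
  -- β)ε/4, the net growth used in `hdiff`.
  set δ := (1 - β) * ε / (4 * (2 + ε)) with hδ
  have hδ0 : 0 < δ := by positivity
  have hhalf : ∀ᶠ n : ℕ in atTop, stepProb w n ≤ 1 / 2 := by
    have : Tendsto (fun n : ℕ => (n : ℝ) ^ (-1 + (1 / 2 : ℝ))) atTop (𝓝 0) := by
      have := (tendsto_rpow_neg_atTop (y := 1 / 2) (by norm_num)).comp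
        (tendsto_natCast_atTop_atTop (R := ℝ))
      refine this.congr fun n => ?_
      norm_num [Function.comp]
    filter_upwards [hq (1 / 2) (by norm_num), this.eventually_le_const (show (0 : ℝ) < 1 / 2 by
      norm_num)] with n h1 h2 using h1.trans h2
  obtain ⟨n₀, hn₀⟩ := eventually_atTop.1 (hev.and (hhalf.and (hW.and
    ((he.eventually_const_lt (show -δ < 0 by linarith)).and (he.eventually_lt_const hδ0)))))
  have hlo : Tendsto (fun N : ℕ => (c * ((1 - β) * ε / 4) / 2) * Real.log N - 1 -
      |A| * Real.log (Real.log N)) atTop atTop := by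
    have h1 : (fun x : ℝ => (c * ((1 - β) * ε / 4) / 2) * x - 1 - |A| * Real.log x) =
        fun x => (c * ((1 - β) * ε / 4) / 2) * x - (1 + |A| * Real.log x) := by
      ext x; ring
    have h2 : Tendsto (fun x : ℝ => (c * ((1 - β) * ε / 4) / 2) * x - (1 + |A| * Real.log x))
        atTop atTop := by
      have ho : (fun x : ℝ => 1 + |A| * Real.log x) =o[atTop]
          fun x => (c * ((1 - β) * ε / 4) / 2) * x := by
        refine Asymptotics.IsLittleO.const_mul_right (by positivity) ?_
        refine Asymptotics.IsLittleO.add ?_ (Real.isLittleO_log_id_atTop.const_mul_left _)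
        exact Asymptotics.isLittleO_const_id_atTop 1
      have := (Asymptotics.IsEquivalent.refl (u := fun x : ℝ =>
        (c * ((1 - β) * ε / 4) / 2) * x) (l := atTop)).sub_isLittleO ho
      exact this.symm.tendsto_atTop (tendsto_id.const_mul_atTop (by positivity))
    rw [← h1] at h2
    exact h2.comp tendsto_log_natCast
  -- Once this quantity is at least 1, rounding N^(1+ε) down still leaves M ≥ N^(1+ε/2).
  have hpow : Tendsto (fun N : ℕ => (N : ℝ) ^ (1 + ε / 2) * ((N : ℝ) ^ (ε / 2) - 1)) atTop
      atTop := by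
    have h1 : Tendsto (fun N : ℕ => (N : ℝ) ^ (1 + ε / 2)) atTop atTop :=
      (tendsto_rpow_atTop (by positivity)).comp tendsto_natCast_atTop_atTop
    have h2 : Tendsto (fun N : ℕ => (N : ℝ) ^ (ε / 2) - 1) atTop atTop :=
      tendsto_atTop_add_const_right _ (-1)
        ((tendsto_rpow_atTop (by positivity)).comp tendsto_natCast_atTop_atTop)
    exact h1.atTop_mul_atTop₀ h2
  filter_upwards [eventually_ge_atTop n₀, eventually_ge_atTop 3, hlo.eventually_ge_atTop 0,
    hpow.eventually_ge_atTop 1, (Real.tendsto_log_atTop.comp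
      tendsto_log_natCast).eventually_gt_atTop 0,
    (Real.tendsto_log_atTop.comp (Real.tendsto_log_atTop.comp
      tendsto_log_natCast)).eventually_gt_atTop 0] with N hN0 hN3 hN4 hN5 hN6 hN7
  set M := ⌊(N : ℝ) ^ (1 + ε)⌋₊ with hM
  have hN1 : (1 : ℝ) ≤ N := by exact_mod_cast (by omega : 1 ≤ N)
  have hNpos : (0 : ℝ) < N := by linarith
  have hMlow : (N : ℝ) ^ (1 + ε / 2) ≤ M := by
    have h1 : (N : ℝ) ^ (1 + ε) = (N : ℝ) ^ (1 + ε / 2) * (N : ℝ) ^ (ε / 2) := by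
      rw [← Real.rpow_add hNpos]; ring_nf
    have h2 : (N : ℝ) ^ (1 + ε) < M + 1 := Nat.lt_floor_add_one _
    nlinarith
  have hNM : N ≤ M := by
    have : (N : ℝ) ≤ (N : ℝ) ^ (1 + ε / 2) := by
      conv_lhs => rw [← Real.rpow_one (N : ℝ)]
      exact Real.rpow_le_rpow_of_exponent_le hN1 (by linarith)
    exact_mod_cast this.trans hMlow
  have hMpos : (0 : ℝ) < M := hNpos.trans_le (by exact_mod_cast hNM)
  have hlogN : 0 ≤ Real.log N := Real.log_nonneg hN1
  have hlogM : (1 + ε / 2) * Real.log N ≤ Real.log M := by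
    rw [← Real.log_rpow hNpos]
    exact Real.log_le_log (Real.rpow_pos_of_pos hNpos _) hMlow
  have hWN : Real.log (totalWeight w N) = (1 - β + e N) * Real.log N := by
    rw [(hn₀ N hN0).2.2.1, Real.log_rpow hNpos]
  have hWM : Real.log (totalWeight w M) = (1 - β + e M) * Real.log M := by
    rw [(hn₀ M (hN0.trans hNM)).2.2.1, Real.log_rpow hMpos]
  have hδ' : δ * (2 + ε) = (1 - β) * ε / 4 := by rw [hδ]; field_simp
  have hdiff : (1 - β) * ε / 4 * Real.log N ≤
      Real.log (totalWeight w M) - Real.log (totalWeight w N) := by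
    rw [hWN, hWM]
    have h1 := (hn₀ N hN0).2.2.2.2
    have h2 := (hn₀ M (hN0.trans hNM)).2.2.2.1
    have hδβ : δ ≤ 1 - β := by
      rw [hδ, div_le_iff₀ (by positivity)]
      nlinarith
    have h3 : (1 - β - δ) * ((1 + ε / 2) * Real.log N) ≤ (1 - β + e M) * Real.log M := by
      refine mul_le_mul (by linarith) hlogM (by positivity) (by linarith)
    have h4 : (1 - β + e N) * Real.log N ≤ (1 - β + δ) * Real.log N := by
      gcongr
    have h5 : (1 - β - δ) * ((1 + ε / 2) * Real.log N) - (1 - β + δ) * Real.log N =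
        ((1 - β) * ε / 2 - δ * (2 + ε) + δ * ε / 2) * Real.log N := by ring
    have h6 : (1 - β) * ε / 4 * Real.log N ≤
        ((1 - β) * ε / 2 - δ * (2 + ε) + δ * ε / 2) * Real.log N := by
      gcongr
      nlinarith [mul_pos hδ0 hε]
    linarith
  have hq2 := log_totalWeight_sub_le hw1 hw (by omega) (fun n hn => (hn₀ n (hN0.trans hn)).2.1) hNM
  have hab := le_sum_div_totalWeight (a := (goodSet lam w α β ε).indicator w) (c := c) hw1 hw
    (fun k hk => indicator_apply_le' (fun _ => le_rfl) (fun _ => hw k hk)) (by omega)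
    (fun n hn => by
      have := (hn₀ n (hN0.trans hn)).1
      exact ((lt_div_iff₀ (totalWeight_pos hw1 hw (by omega))).1 this).le) hNM
  have hnn : 0 ≤ (∑ k ∈ Finset.Icc 1 M, (goodSet lam w α β ε).indicator w k) / totalWeight w M :=
    div_nonneg (Finset.sum_nonneg fun k hk => indicator_nonneg (fun i hi => hw i hi.1) k)
      (totalWeight_nonneg hw M)
  have hfin : ∑ k ∈ Finset.Ioc N M, (goodSet lam w α β ε).indicator w k / totalWeight w k ≤
      ∑ k ∈ (Finset.Icc N M).filter fun k : ℕ => (k : ℝ) ^ (-α - ε) ≤ lam k, stepProb w k := by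
    refine le_trans ?_ (sum_indicator_goodSet_le (β := β) hw _)
    have : ∀ k, (goodSet lam w α β ε).indicator w k / totalWeight w k =
        (goodSet lam w α β ε).indicator (fun k => w k / totalWeight w k) k := by
      intro k
      by_cases hk : k ∈ goodSet lam w α β ε <;> simp [hk]
    simp_rw [this]
    exact Finset.sum_le_sum_of_subset_of_nonneg Finset.Ioc_subset_Icc_self
      fun i _ _ => indicator_nonneg (fun k hk => stepProb_nonneg hw k) i
  have hlll : A * Real.log (Real.log (Real.log N)) ≤ |A| * Real.log (Real.log N) := by
    have hx : Real.log (Real.log (Real.log N)) ≤ Real.log (Real.log N) :=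
      (Real.log_le_sub_one_of_pos hN6).trans (by simp)
    exact (mul_le_mul_of_nonneg_right (le_abs_self A) hN7.le).trans
      (mul_le_mul_of_nonneg_left hx (abs_nonneg A))
  have : c * ((1 - β) * ε / 4 * Real.log N) ≤ c * (2 * ∑ k ∈ Finset.Ioc N M, stepProb w k) :=
    mul_le_mul_of_nonneg_left (hdiff.trans hq2) hc.le
  linarith

end Weights

/-! ### Summability estimates and doubly exponential scales. -/

section Scales

variable {lam w : ℕ → ℝ} {α : ℝ}

/-- The general term is at most k^(-1-α/2). The sum controls the mean distance from a random point
to the root, and so places the limit points in ℓ¹. -/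
theorem GrowthBounds.summable_lam_mul (h : GrowthBounds lam w α) (hlam : ∀ n, 1 ≤ n → 0 < lam n)
    (hw : ∀ n, 1 ≤ n → 0 ≤ w n) : Summable fun k => lam k * stepProb w k := by
  have hα := h.α_pos
  refine Summable.of_norm_bounded_eventually_nat
    (Real.summable_nat_rpow.2 (show -1 - α / 2 < -1 by linarith)) ?_
  filter_upwards [h.lam_le (α / 4) (by positivity), h.stepProb_le (α / 4) (by positivity),
    eventually_ge_atTop 1] with n h1 h2 h3
  have hn : (0 : ℝ) < n := by exact_mod_cast h3
  rw [Real.norm_of_nonneg (mul_nonneg (hlam n h3).le (stepProb_nonneg hw n))]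
  calc lam n * stepProb w n ≤ (n : ℝ) ^ (-α + α / 4) * (n : ℝ) ^ (-1 + α / 4) :=
        mul_le_mul h1 h2 (stepProb_nonneg hw n) (by positivity)
    _ = (n : ℝ) ^ (-1 - α / 2) := by rw [← Real.rpow_add hn]; ring_nf

theorem GrowthBounds.summable_stepProb_sq (h : GrowthBounds lam w α)
    (hw : ∀ n, 1 ≤ n → 0 ≤ w n) : Summable fun k => stepProb w k ^ 2 := by
  refine Summable.of_norm_bounded_eventually_nat
    (Real.summable_nat_rpow.2 (show -(3 / 2 : ℝ) < -1 by norm_num)) ?_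
  filter_upwards [h.stepProb_le (1 / 4) (by positivity), eventually_ge_atTop 1] with n h2 h3
  have hn : (0 : ℝ) < n := by exact_mod_cast h3
  rw [Real.norm_of_nonneg (sq_nonneg _)]
  calc stepProb w n ^ 2 ≤ ((n : ℝ) ^ (-1 + (1 / 4 : ℝ))) ^ 2 :=
        pow_le_pow_left₀ (stepProb_nonneg hw n) h2 2
    _ = (n : ℝ) ^ (-(3 / 2 : ℝ)) := by
        rw [← Real.rpow_natCast, ← Real.rpow_mul hn.le]; norm_num

/-- A bound on the second moment of the mass of the subtree of the `k`-th block. -/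
noncomputable def subtreeBound (w : ℕ → ℝ) (k : ℕ) : ℝ :=
  stepProb w k ^ 2 + stepProb w k * ∑' i, stepProb w (i + (k + 1)) ^ 2

/-- With q_k ≤ k^(-1+δ), both terms of `subtreeBound` are O(k^(-2+4δ)). The choice δ = ε/8 leaves a
general term of order k^(-1-ε/2). -/
theorem GrowthBounds.summable_subtreeBound (h : GrowthBounds lam w α)
    (hw : ∀ n, 1 ≤ n → 0 ≤ w n) {ε : ℝ} (hε : 0 < ε) (hε1 : ε < 1) :
    Summable fun k : ℕ => (k : ℝ) ^ (1 - ε) * subtreeBound w k := by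
  set δ := ε / 8 with hδ
  have hδ0 : 0 < δ := by positivity
  set C : ℝ := ∑' i : ℕ, (i : ℝ) ^ (-1 - δ) with hC
  have hsum : Summable fun i : ℕ => (i : ℝ) ^ (-1 - δ) :=
    Real.summable_nat_rpow.2 (by linarith)
  have hCk : ∀ k : ℕ, ∑' i : ℕ, ((i + (k + 1) : ℕ) : ℝ) ^ (-1 - δ) ≤ C := by
    intro k
    rw [hC, ← hsum.sum_add_tsum_nat_add (k + 1)]
    exact le_add_of_nonneg_left (Finset.sum_nonneg fun i _ => by positivity)
  refine Summable.of_norm_bounded_eventually_nat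
    ((Real.summable_nat_rpow.2 (show -1 - ε / 2 < -1 by linarith)).mul_left (1 + C)) ?_
  obtain ⟨n₀, hn₀⟩ := eventually_atTop.1 (h.stepProb_le δ hδ0)
  filter_upwards [eventually_ge_atTop n₀, eventually_ge_atTop 1] with k hk hk1
  have hk1' : (1 : ℝ) ≤ k := by exact_mod_cast hk1
  have hk0 : (0 : ℝ) < k := by linarith
  have hq : ∀ i : ℕ, k ≤ i → stepProb w i ^ 2 ≤ (i : ℝ) ^ (-2 + 2 * δ) := by
    intro i hi
    have hi0 : (0 : ℝ) < i := hk0.trans_le (by exact_mod_cast hi)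
    calc stepProb w i ^ 2 ≤ ((i : ℝ) ^ (-1 + δ)) ^ 2 :=
          pow_le_pow_left₀ (stepProb_nonneg hw i) (hn₀ i (hk.trans hi)) 2
      _ = (i : ℝ) ^ (-2 + 2 * δ) := by
          rw [← Real.rpow_natCast, ← Real.rpow_mul hi0.le]; push_cast; ring_nf
  have hq2 : ∀ i : ℕ, k ≤ i → stepProb w i ^ 2 ≤ (k : ℝ) ^ (-1 + 3 * δ) * (i : ℝ) ^ (-1 - δ) := by
    intro i hi
    have hi0 : (0 : ℝ) < i := hk0.trans_le (by exact_mod_cast hi)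
    refine (hq i hi).trans ?_
    -- The second factor stays summable in i; the first has a negative exponent, so i ≥ k lets it be
    -- replaced by its value at k.
    have : (-2 + 2 * δ) = (-1 + 3 * δ) + (-1 - δ) := by ring
    rw [this, Real.rpow_add hi0]
    gcongr ?_ * _
    exact Real.rpow_le_rpow_of_nonpos hk0 (by exact_mod_cast hi) (by linarith)
  have hs := h.summable_stepProb_sq hw
  have htail : ∑' i, stepProb w (i + (k + 1)) ^ 2 ≤ (k : ℝ) ^ (-1 + 3 * δ) * C := by
    refine le_trans ?_ (mul_le_mul_of_nonneg_left (hCk k) (by positivity))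
    rw [← tsum_mul_left]
    refine Summable.tsum_le_tsum (fun i => hq2 _ (by omega))
      ((summable_nat_add_iff (f := fun i => stepProb w i ^ 2) (k + 1)).2 hs) ?_
    exact ((summable_nat_add_iff (f := fun i : ℕ => (i : ℝ) ^ (-1 - δ)) (k + 1)).2 hsum).mul_left _
  have htail0 : 0 ≤ ∑' i, stepProb w (i + (k + 1)) ^ 2 := tsum_nonneg fun i => sq_nonneg _
  have hb0 : 0 ≤ subtreeBound w k :=
    add_nonneg (sq_nonneg _) (mul_nonneg (stepProb_nonneg hw k) htail0)
  have hC0 : 0 ≤ C := tsum_nonneg fun i => by positivity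
  have hb : subtreeBound w k ≤ (1 + C) * (k : ℝ) ^ (-2 + 4 * δ) := by
    have h1 : stepProb w k ^ 2 ≤ (k : ℝ) ^ (-2 + 4 * δ) :=
      (hq k le_rfl).trans (Real.rpow_le_rpow_of_exponent_le hk1' (by linarith))
    have h2 : stepProb w k * ∑' i, stepProb w (i + (k + 1)) ^ 2 ≤
        (k : ℝ) ^ (-1 + δ) * ((k : ℝ) ^ (-1 + 3 * δ) * C) :=
      mul_le_mul (hn₀ k hk) htail htail0 (by positivity)
    have h3 : (k : ℝ) ^ (-1 + δ) * ((k : ℝ) ^ (-1 + 3 * δ) * C) = C * (k : ℝ) ^ (-2 + 4 * δ) := by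
      rw [← mul_assoc, ← Real.rpow_add hk0, mul_comm]; ring_nf
    rw [subtreeBound]
    linarith
  rw [Real.norm_of_nonneg (by positivity)]
  calc (k : ℝ) ^ (1 - ε) * subtreeBound w k
      ≤ (k : ℝ) ^ (1 - ε) * ((1 + C) * (k : ℝ) ^ (-2 + 4 * δ)) := by gcongr
    _ = (1 + C) * ((k : ℝ) ^ (1 - ε) * (k : ℝ) ^ (-2 + 4 * δ)) := by ring
    _ = (1 + C) * (k : ℝ) ^ (-1 - ε / 2) := by
        rw [← Real.rpow_add hk0, hδ]; ring_nf

/-- A doubly exponential sequence of scales. -/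
noncomputable def scale (ε : ℝ) (j : ℕ) : ℝ := Real.exp ((1 + ε) ^ j)

/-- The indices `k` of order between `scale ε j` and `scale ε (j + 1)` with
`lam k ≥ k ^ (-α - ε)`. -/
noncomputable def scaleIndices (lam : ℕ → ℝ) (α ε : ℝ) (j : ℕ) : Finset ℕ :=
  (Finset.Icc ⌈scale ε j⌉₊ ⌊(⌈scale ε j⌉₊ : ℝ) ^ (1 + ε)⌋₊).filter
    fun k : ℕ => (k : ℝ) ^ (-α - ε) ≤ lam k

theorem scale_pos (ε : ℝ) (j : ℕ) : 0 < scale ε j := Real.exp_pos _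

theorem scale_succ {ε : ℝ} (j : ℕ) : scale ε (j + 1) = scale ε j ^ (1 + ε) := by
  rw [scale, scale, ← Real.exp_mul, pow_succ]

theorem tendsto_scale {ε : ℝ} (hε : 0 < ε) : Tendsto (scale ε) atTop atTop :=
  Real.tendsto_exp_atTop.comp (tendsto_pow_atTop_atTop_of_one_lt (by linarith))

theorem scale_add_one_le {ε : ℝ} (hε : 0 < ε) :
    ∀ᶠ j in atTop, scale ε j + 1 ≤ scale ε (j + 1) := by
  have h1 : Tendsto (fun j : ℕ => ε * (1 + ε) ^ j) atTop atTop :=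
    (tendsto_pow_atTop_atTop_of_one_lt (by linarith)).const_mul_atTop hε
  filter_upwards [h1.eventually_ge_atTop 1] with j hj
  have h2 : scale ε (j + 1) = scale ε j * Real.exp (ε * (1 + ε) ^ j) := by
    rw [scale, scale, ← Real.exp_add]; ring_nf
  have h3 := Real.add_one_le_exp (ε * (1 + ε) ^ j)
  have h4 : 1 ≤ scale ε j := Real.one_le_exp (by positivity)
  rw [h2]
  nlinarith

theorem scale_le_of_mem {ε : ℝ} {j k : ℕ} (hk : k ∈ scaleIndices lam α ε j) :
    scale ε j ≤ k :=
  (Nat.le_ceil _).trans (by exact_mod_cast (Finset.mem_Icc.1 (Finset.mem_filter.1 hk).1).1)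

theorem one_le_of_mem_scaleIndices {ε : ℝ} {j k : ℕ} (hk : k ∈ scaleIndices lam α ε j) :
    1 ≤ k := by
  have := (scale_pos ε j).trans_le (scale_le_of_mem hk)
  exact_mod_cast this

/-- Rounding `scale ε j` up stays below `scale ε (j + 1)`, and the power 1 + ε moves one scale
further; hence the shift by two. -/
theorem le_scale_of_mem {ε : ℝ} (hε : 0 < ε) :
    ∀ᶠ j in atTop, ∀ k ∈ scaleIndices lam α ε j, (k : ℝ) ≤ scale ε (j + 2) := by
  filter_upwards [scale_add_one_le hε] with j hj k hk
  have h1 := (Finset.mem_Icc.1 (Finset.mem_filter.1 hk).1).2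
  calc (k : ℝ) ≤ (⌈scale ε j⌉₊ : ℝ) ^ (1 + ε) :=
        (Nat.le_floor_iff (by positivity)).1 h1
    _ ≤ scale ε (j + 1) ^ (1 + ε) := by
        gcongr
        exact (Nat.ceil_lt_add_one (scale_pos ε j).le).le.trans hj
    _ = scale ε (j + 2) := (scale_succ (j + 1)).symm

/-- From 1 - x ≤ exp(-x) and `le_sum` with A = 2/p, the product is at most exp(-2 log log log N)
with N = ⌈t_j⌉. As log log t_j = j log(1 + ε), this is O(j⁻²): the triple logarithm is what doubly
exponential scales require. -/
theorem GrowthBounds.summable_prod (h : GrowthBounds lam w α) (hw : ∀ n, 1 ≤ n → 0 ≤ w n)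
    {ε p : ℝ} (hε : 0 < ε) (hp : 0 < p) (hp1 : p ≤ 1) :
    Summable fun j => ∏ k ∈ scaleIndices lam α ε j, (1 - p * stepProb w k) := by
  have hlog : 0 < Real.log (1 + ε) := Real.log_pos (by linarith)
  refine Summable.of_norm_bounded_eventually_nat (g := fun j : ℕ =>
    (Real.log (1 + ε))⁻¹ ^ 2 * (1 / (j : ℝ) ^ 2))
    ((Real.summable_one_div_nat_pow.2 (by norm_num)).mul_left _) ?_
  have hN : Tendsto (fun j => ⌈scale ε j⌉₊) atTop atTop :=
    tendsto_nat_ceil_atTop.comp (tendsto_scale hε)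
  filter_upwards [hN.eventually (h.le_sum ε hε (2 / p)), eventually_ge_atTop 1,
    (tendsto_scale hε).eventually_gt_atTop 1] with j hj hj1 hj2
  have hterm : ∀ k, 0 ≤ 1 - p * stepProb w k := fun k => by
    nlinarith [stepProb_nonneg hw k, stepProb_le_one hw k]
  rw [Real.norm_of_nonneg (Finset.prod_nonneg fun k _ => hterm k)]
  have hj0 : (0 : ℝ) < j := by exact_mod_cast hj1
  have hx : (j : ℝ) * Real.log (1 + ε) ≤ Real.log (Real.log ⌈scale ε j⌉₊) := by
    rw [← Real.log_pow]
    refine Real.log_le_log (by positivity) ?_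
    calc (1 + ε) ^ j = Real.log (scale ε j) := (Real.log_exp _).symm
      _ ≤ Real.log ⌈scale ε j⌉₊ := Real.log_le_log (scale_pos ε j) (Nat.le_ceil _)
  have hx0 : 0 < (j : ℝ) * Real.log (1 + ε) := by positivity
  calc ∏ k ∈ scaleIndices lam α ε j, (1 - p * stepProb w k)
      ≤ ∏ k ∈ scaleIndices lam α ε j, Real.exp (-(p * stepProb w k)) :=
        Finset.prod_le_prod (fun k _ => hterm k) fun k _ => Real.one_sub_le_exp_neg _
    _ = Real.exp (-(p * ∑ k ∈ scaleIndices lam α ε j, stepProb w k)) := by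
        rw [← Real.exp_sum, Finset.sum_neg_distrib, Finset.mul_sum]
    _ ≤ Real.exp (-(2 * Real.log ((j : ℝ) * Real.log (1 + ε)))) := by
        rw [Real.exp_le_exp, neg_le_neg_iff]
        calc 2 * Real.log ((j : ℝ) * Real.log (1 + ε))
            ≤ 2 * Real.log (Real.log (Real.log ⌈scale ε j⌉₊)) := by
              gcongr
          _ = p * (2 / p * Real.log (Real.log (Real.log ⌈scale ε j⌉₊))) := by field_simp
          _ ≤ _ := mul_le_mul_of_nonneg_left hj hp.le
    _ = (Real.log (1 + ε))⁻¹ ^ 2 * (1 / (j : ℝ) ^ 2) := by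
        have : -(2 * Real.log ((j : ℝ) * Real.log (1 + ε))) =
            Real.log ((((j : ℝ) * Real.log (1 + ε)) ^ 2)⁻¹) := by
          rw [Real.log_inv, Real.log_pow]; norm_num
        rw [this, Real.exp_log (by positivity)]
        field_simp

end Scales

/-! ### A mass distribution principle for the set of leaves -/

section Truncation

variable {U : Type*} [MetricSpace U] {u₀ : U} {lam : ℕ → ℝ} {hlam : ∀ n, 1 ≤ n → 0 < lam n}

/-- The sequence `x` with the coordinates of index larger than `n` replaced by `u₀`. -/
def truncateSeq (u₀ : U) (n : ℕ) (x : ℕ → U) : ℕ → U := fun i => if i ≤ n then x i else u₀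

theorem EllOne.coord_update (p : EllOne u₀ lam hlam) (k : ℕ) (hk : 1 ≤ k) (x : U) :
    (p.update k hk x).coord = Function.update p.coord k x := rfl

theorem gluePoint_coord_of_lt (K : ℕ → ℕ) (Z : ℕ → U) (n : ℕ) {i : ℕ} (hi : n < i) :
    (gluePoint u₀ lam hlam K Z n).coord i = u₀ := by
  induction n using Nat.strong_induction_on with
  | _ n ih =>
    rw [gluePoint]
    split_ifs with h
    · rw [EllOne.coord_update, Function.update_of_ne (by omega)]
      exact ih _ (by omega) (by omega)
    · rfl

/-- The distance is the tail of the convergent series ∑ λ_i dist(y_i, u₀). -/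
theorem tendsto_dist_truncateSeq (y : EllOne u₀ lam hlam) (z : ℕ → EllOne u₀ lam hlam)
    (hz : ∀ n, 1 ≤ n → (z n).coord = truncateSeq u₀ n y.coord) :
    Tendsto (fun n => dist (z n) y) atTop (𝓝 0) := by
  have ht := tendsto_sum_nat_add (fun n => lam n * dist (y.coord n) u₀)
  refine ((tendsto_add_atTop_iff_nat 1).2 ht).congr' ?_
  filter_upwards [eventually_ge_atTop 1] with n hn
  have h := EllOne.summable_dist (z n) y
  rw [EllOne.dist_def, ← h.sum_add_tsum_nat_add (n + 1), Finset.sum_eq_zero, zero_add]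
  · refine tsum_congr fun i => ?_
    rw [hz n hn, truncateSeq, if_neg (by omega), dist_comm]
  · intro i hi
    rw [hz n hn, truncateSeq, if_pos (Nat.lt_succ_iff.1 (Finset.mem_range.1 hi)), dist_self,
      mul_zero]

/-- A point at distance less than `lam k * dist (x k) u₀` from `x` has a nontrivial `k`-th
coordinate. -/
theorem EllOne.coord_ne_of_dist_lt {x y : EllOne u₀ lam hlam} {k : ℕ}
    (h : dist x y < lam k * dist (x.coord k) u₀) : y.coord k ≠ u₀ := by
  intro hy
  have := EllOne.term_le_dist x y k
  rw [hy] at this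
  linarith

variable [MeasurableSpace U]

theorem coord_eq_of_mem_glued {b : ℕ → Block u₀} {K : ℕ → ℕ} {Z : ℕ → U} {n : ℕ}
    {y : EllOne u₀ lam hlam} (hy : y ∈ glued lam hlam b K Z n) {i : ℕ} (hi : n < i) :
    y.coord i = u₀ := by
  simp only [glued, mem_iUnion] at hy
  obtain ⟨k, hk, hkn, x, -, rfl⟩ := hy
  show Function.update _ _ _ _ = _
  rw [Function.update_of_ne (by omega)]
  exact gluePoint_coord_of_lt K Z _ (by omega)

/-- The truncations are points of 𝒯ₙ converging to y, so y lies in the closure. Points of 𝒯ₙ have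
trivial coordinates beyond n, so infinitely many nontrivial coordinates exclude the skeleton. -/
theorem mem_leaves {b : ℕ → Block u₀} {K : ℕ → ℕ} {Z : ℕ → U} {y : EllOne u₀ lam hlam}
    (h : ∀ n, 1 ≤ n → truncateSeq u₀ n y.coord ∈ EllOne.coord '' glued lam hlam b K Z n)
    (h' : ∃ᶠ k in atTop, y.coord k ≠ u₀) : y ∈ leaves lam hlam b K Z := by
  refine ⟨?_, fun hy => ?_⟩
  · have : Nonempty (EllOne u₀ lam hlam) := ⟨y⟩
    choose! z hz hzy using h
    refine mem_closure_of_tendsto (tendsto_iff_dist_tendsto_zero.2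
      (tendsto_dist_truncateSeq y z hzy)) ?_
    filter_upwards [eventually_ge_atTop 1] with n hn
    exact mem_iUnion.2 ⟨n, hz n hn⟩
  · obtain ⟨n, hn⟩ := mem_iUnion.1 hy
    obtain ⟨k, hk, hne⟩ := (h'.and_eventually (eventually_gt_atTop n)).exists
    exact hk (coord_eq_of_mem_glued hn hne)

/-- Mass distribution principle. A set meeting A at x with diameter below r j lies in {y | y k ≠ u₀}
for the index k attached to x and j, so its mass is at most v j ≤ r (j + 1)^s. Thus the mass is
dominated by the s-dimensional Hausdorff measure. -/
theorem le_dimH_leaves {b : ℕ → Block u₀} {K : ℕ → ℕ} {Z : ℕ → U} (μ : Measure (ℕ → U))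
    {A : Set (ℕ → U)} (hA : μ A ≠ 0)
    (hzero : ∀ x ∈ A, x 0 = u₀) (hsum : ∀ x ∈ A, Summable fun n => lam n * dist (x n) u₀)
    (htrunc : ∀ x ∈ A, ∀ n, 1 ≤ n →
      truncateSeq u₀ n x ∈ EllOne.coord '' glued lam hlam b K Z n)
    (hne : ∀ x ∈ A, ∃ᶠ k in atTop, x k ≠ u₀)
    {r v : ℕ → ℝ} (hr : ∀ j, 0 < r j) (hr0 : Tendsto r atTop (𝓝 0)) {s : NNReal} (hs : 0 < s)
    (hv : ∀ᶠ j in atTop, v j ≤ r (j + 1) ^ (s : ℝ)) {j₀ : ℕ}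
    (hball : ∀ x ∈ A, ∀ j, j₀ ≤ j → ∃ k, r j ≤ lam k * dist (x k) u₀ ∧
      μ {y | y k ≠ u₀} ≤ ENNReal.ofReal (v j)) :
    (s : ℝ≥0∞) ≤ dimH (leaves lam hlam b K Z) := by
  let _ : MeasurableSpace (EllOne u₀ lam hlam) := borel _
  have : BorelSpace (EllOne u₀ lam hlam) := ⟨rfl⟩
  obtain ⟨j₁, hj₁⟩ := eventually_atTop.1 hv
  set J := max j₀ j₁ with hJ
  set L : Set (EllOne u₀ lam hlam) := EllOne.coord ⁻¹' A with hL
  have hLs : L ⊆ leaves lam hlam b K Z := fun y hy => mem_leaves (htrunc _ hy) (hne _ hy)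
  -- μ lives on the product space and the Hausdorff measure on ℓ¹. Comparing outer measures
  -- transports μ without any measurability of A or of its image.
  set m : OuterMeasure (EllOne u₀ lam hlam) :=
    OuterMeasure.comap EllOne.coord (OuterMeasure.restrict A μ.toOuterMeasure) with hm
  have hmapply : ∀ t, m t = μ (EllOne.coord '' t ∩ A) := fun t => by
    rw [hm, OuterMeasure.comap_apply, OuterMeasure.restrict_apply]; rfl
  -- a set of small diameter has small mass
  have hsmall : ∀ (t : Set (EllOne u₀ lam hlam)) (j : ℕ), J ≤ j →
      Metric.ediam t < ENNReal.ofReal (r j) → m t ≤ ENNReal.ofReal (r (j + 1)) ^ (s : ℝ) := by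
    intro t j hj ht
    rw [hmapply]
    rcases (EllOne.coord '' t ∩ A).eq_empty_or_nonempty with h0 | ⟨_, ⟨x, hxt, rfl⟩, hxA⟩
    · rw [h0, measure_empty]; exact zero_le
    obtain ⟨k, hk, hμk⟩ := hball _ hxA j ((le_max_left _ _).trans hj)
    refine (measure_mono ?_).trans (hμk.trans ?_)
    · rintro _ ⟨⟨y, hyt, rfl⟩, -⟩
      refine EllOne.coord_ne_of_dist_lt (x := x) (lt_of_lt_of_le ?_ hk)
      have := (Metric.edist_le_ediam_of_mem hxt hyt).trans_lt ht
      rwa [edist_dist, ENNReal.ofReal_lt_ofReal_iff (hr j)] at this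
    · rw [ENNReal.ofReal_rpow_of_pos (hr _)]
      exact ENNReal.ofReal_le_ofReal (hj₁ j ((le_max_right _ _).trans hj))
  have hr0' : Tendsto (fun j => ENNReal.ofReal (r j)) atTop (𝓝 0) := by
    simpa using ENNReal.tendsto_ofReal hr0
  have hle : m ≤ OuterMeasure.mkMetric fun d => d ^ (s : ℝ) := by
    refine OuterMeasure.le_mkMetric _ m (ENNReal.ofReal (r J) / 2)
      (ENNReal.half_pos (ENNReal.ofReal_pos.2 (hr J)).ne') fun t ht => ?_
    have htJ : Metric.ediam t < ENNReal.ofReal (r J) :=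
      ht.trans_lt (ENNReal.half_lt_self (ENNReal.ofReal_pos.2 (hr J)).ne' ENNReal.ofReal_ne_top)
    -- `r` need not be monotone. The first radius not exceeding the diameter is not r J, so its
    -- predecessor exceeds the diameter and `hsmall` applies there.
    by_cases hex : ∃ i, ENNReal.ofReal (r (J + i)) ≤ Metric.ediam t
    · classical
      have hi := Nat.find_spec hex
      have hi0 : Nat.find hex ≠ 0 := by
        intro h
        rw [h] at hi
        exact absurd hi (not_le.2 htJ)
      obtain ⟨i, hieq⟩ := Nat.exists_eq_succ_of_ne_zero hi0
      have hlt := not_le.1 (Nat.find_min hex (m := i) (by omega))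
      rw [hieq] at hi
      exact (hsmall t (J + i) (by omega) hlt).trans
        (ENNReal.rpow_le_rpow hi s.2)
    · push Not at hex
      -- The diameter is below every radius from J on, so the mass is below quantities tending to 0.
      have h1 : Tendsto (fun i => ENNReal.ofReal (r (J + i + 1)) ^ (s : ℝ)) atTop (𝓝 0) := by
        have h2 : Tendsto (fun i => J + i + 1) atTop atTop :=
          tendsto_atTop_mono (fun i => show i ≤ J + i + 1 by omega) tendsto_id
        have := (hr0'.comp h2).ennrpow_const (s : ℝ)
        rwa [ENNReal.zero_rpow_of_pos (by exact_mod_cast hs)] at this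
      have : m t ≤ 0 := ge_of_tendsto' h1 fun i => hsmall t (J + i) (by omega) (hex i)
      exact this.trans zero_le
  refine le_dimH_of_hausdorffMeasure_ne_zero fun h0 => hA ?_
  have h1 : Measure.hausdorffMeasure (s : ℝ) L = 0 := measure_mono_null hLs h0
  have h2 : m L ≤ 0 := by
    refine (hle L).trans (le_of_eq ?_)
    rw [← h1, Measure.hausdorffMeasure, ← Measure.mkMetric_toOuterMeasure]
    rfl
  rw [hmapply] at h2
  refine measure_mono_null (fun x hx => ?_) (le_antisymm h2 zero_le)
  exact ⟨⟨⟨x, hzero x hx, hsum x hx⟩, hx, rfl⟩, hx⟩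

end Truncation

/-! ### Weak limits -/

section Limits

theorem ENNReal.tsum_liminf_le_liminf_tsum (f : ℕ → ℕ → ℝ≥0∞) :
    ∑' k, liminf (fun n => f n k) atTop ≤ liminf (fun n => ∑' k, f n k) atTop := by
  simp_rw [← lintegral_count]
  exact lintegral_liminf_le fun n => measurable_of_countable (f n)

variable {X : Type*} [MeasurableSpace X]

/-- Probability measures carried by a common compact set have a subsequence, along which a property
satisfied infinitely often holds, that converges weakly. -/
theorem exists_limit_measure [TopologicalSpace X] [BorelSpace X] [PolishSpace X]
    (ν : ℕ → Measure X) [∀ n, IsProbabilityMeasure (ν n)] {C : Set X} (hC : IsCompact C)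
    (hνC : ∀ n, ν n Cᶜ = 0) {p : ℕ → Prop} (hp : ∃ᶠ n in atTop, p n) :
    ∃ θ : ℕ → ℕ, StrictMono θ ∧ (∀ n, p (θ n)) ∧ ∃ μ : Measure X, IsProbabilityMeasure μ ∧
      ∀ G, IsOpen G → μ G ≤ liminf (fun n => ν (θ n) G) atTop := by
  let _ := TopologicalSpace.upgradeIsCompletelyMetrizable X
  obtain ⟨φ, hφ, hpφ⟩ := extraction_of_frequently_atTop hp
  let ρ : ℕ → ProbabilityMeasure X := fun n => ⟨ν (φ n), inferInstance⟩
  have hcpt : IsCompact (closure (range ρ)) := by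
    refine isCompact_closure_of_isTightMeasureSet
      (isTightMeasureSet_iff_exists_isCompact_measure_compl_le.2 fun ε hε => ⟨C, hC, ?_⟩)
    rintro _ ⟨_, ⟨n, rfl⟩, rfl⟩
    exact (hνC (φ n)).le.trans zero_le
  obtain ⟨μ, -, ψ, hψ, hlim⟩ := hcpt.tendsto_subseq (x := ρ)
    fun n => subset_closure (mem_range_self n)
  exact ⟨φ ∘ ψ, hφ.comp hψ, fun n => hpφ _, μ, inferInstance, fun G hG =>
    ProbabilityMeasure.le_liminf_measure_open_of_tendsto hlim hG⟩

variable {μ : Measure X} {ν : ℕ → Measure X}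

theorem measure_eq_zero_of_le_liminf {G : Set X} (h : μ G ≤ liminf (fun n => ν n G) atTop)
    (h0 : ∀ᶠ n in atTop, ν n G = 0) : μ G = 0 := by
  refine le_antisymm (h.trans ?_) zero_le
  rw [liminf_congr h0]
  simp

/-- The conditions N j n cover estimates on the j-th term that are available only for large n. Each
one holds eventually, so it disappears in the termwise liminf, and Fatou for the counting measure
concludes. -/
theorem tsum_measure_le_of_le_liminf {G : ℕ → Set X}
    (h : ∀ j, μ (G j) ≤ liminf (fun n => ν n (G j)) atTop) {N : ℕ → ℕ → Prop}
    [∀ j n, Decidable (N j n)] (hN : ∀ j, ∀ᶠ n in atTop, N j n) {M : ℝ≥0∞}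
    (hM : ∀ n, ∑' j, (if N j n then ν n (G j) else 0) ≤ M) : ∑' j, μ (G j) ≤ M := by
  calc ∑' j, μ (G j)
      ≤ ∑' j, liminf (fun n => if N j n then ν n (G j) else 0) atTop := by
        refine ENNReal.tsum_le_tsum fun j => (h j).trans (le_of_eq (liminf_congr ?_))
        filter_upwards [hN j] with n hn
        rw [if_pos hn]
    _ ≤ liminf (fun n => ∑' j, (if N j n then ν n (G j) else 0)) atTop :=
        ENNReal.tsum_liminf_le_liminf_tsum _
    _ ≤ liminf (fun _ : ℕ => M) atTop := liminf_le_liminf (Eventually.of_forall hM)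
    _ = M := by simp

/-- x ↦ c x² is monotone and continuous for finite c, so it commutes with the liminf; Fatou for sums
does the rest. -/
theorem tsum_measure_sq_le_of_le_liminf {G : ℕ → Set X} {c : ℕ → ℝ≥0∞} (hc : ∀ k, c k ≠ ∞)
    (h : ∀ j, μ (G j) ≤ liminf (fun n => ν n (G j)) atTop) {M : ℝ≥0∞}
    (hM : ∀ n, ∑' j, c j * ν n (G j) ^ 2 ≤ M) : ∑' j, c j * μ (G j) ^ 2 ≤ M := by
  calc ∑' j, c j * μ (G j) ^ 2
      ≤ ∑' j, liminf (fun n => c j * ν n (G j) ^ 2) atTop := by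
        refine ENNReal.tsum_le_tsum fun j => ?_
        have hmono : Monotone fun x : ℝ≥0∞ => c j * x ^ 2 := fun x y hxy => by
          dsimp only; gcongr
        have hcont : Continuous fun x : ℝ≥0∞ => c j * x ^ 2 :=
          (ENNReal.continuous_const_mul (hc j)).comp (ENNReal.continuous_pow 2)
        refine (hmono (h j)).trans (le_of_eq ?_)
        exact hmono.map_liminf_of_continuousAt _ hcont.continuousAt
    _ ≤ liminf (fun n => ∑' j, c j * ν n (G j) ^ 2) atTop :=
        ENNReal.tsum_liminf_le_liminf_tsum _
    _ ≤ liminf (fun _ : ℕ => M) atTop := liminf_le_liminf (Eventually.of_forall hM)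
    _ = M := by simp

theorem tsum_lintegral_le_of_le_liminf [TopologicalSpace X] [BorelSpace X] {f : ℕ → X → ℝ} (hf : ∀ k, Continuous (f k))
    (hf0 : ∀ k x, 0 ≤ f k x) (h : ∀ G, IsOpen G → μ G ≤ liminf (fun n => ν n G) atTop) {M : ℝ≥0∞}
    (hM : ∀ n, ∑' k, ∫⁻ x, ENNReal.ofReal (f k x) ∂ν n ≤ M) :
    ∑' k, ∫⁻ x, ENNReal.ofReal (f k x) ∂μ ≤ M := by
  calc ∑' k, ∫⁻ x, ENNReal.ofReal (f k x) ∂μ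
      ≤ ∑' k, liminf (fun n => ∫⁻ x, ENNReal.ofReal (f k x) ∂ν n) atTop :=
        ENNReal.tsum_le_tsum fun k =>
          lintegral_le_liminf_lintegral_of_forall_isOpen_measure_le_liminf_measure (hf k)
            (hf0 k) h
    _ ≤ liminf (fun n => ∑' k, ∫⁻ x, ENNReal.ofReal (f k x) ∂ν n) atTop :=
        ENNReal.tsum_liminf_le_liminf_tsum _
    _ ≤ liminf (fun _ : ℕ => M) atTop := liminf_le_liminf (Eventually.of_forall hM)
    _ = M := by simp

end Limits

/-! ### From a limit measure to a dimension bound. -/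

section DimensionBound

/-- The lower bound on the dimension obtained from the scales `scale ε j`. -/
noncomputable def dimBound (α ε : ℝ) : ℝ := (1 - 2 * ε) / ((1 + ε) ^ 3 * (α + ε))

theorem tendsto_dimBound {α : ℝ} (hα : 0 < α) :
    Tendsto (dimBound α) (𝓝 0) (𝓝 (1 / α)) := by
  have : ContinuousAt (dimBound α) 0 := by
    unfold dimBound
    refine ContinuousAt.div (by fun_prop) (by fun_prop) (by simpa using hα.ne')
  simpa [ContinuousAt, dimBound] using this

theorem scale_add_three {ε : ℝ} (j : ℕ) : scale ε (j + 3) = scale ε j ^ ((1 + ε) ^ 3) := by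
  rw [scale, scale, ← Real.exp_mul, pow_add]

/-- Borel–Cantelli under μ itself: if S k is heavier than k^(-(1-ε)), then μ (S k) ≤ k^(1-ε) μ (S
k)², so the heavy sets have summable masses and almost every point lies in only finitely many of
them. -/
theorem ae_eventually_measure_le {X : Type*} [MeasurableSpace X] {μ : Measure X}
    [IsProbabilityMeasure μ] {S : ℕ → Set X} {ε : ℝ}
    (h : ∑' k : ℕ, ENNReal.ofReal ((k : ℝ) ^ (1 - ε)) * μ (S k) ^ 2 ≠ ∞) :
    ∀ᵐ x ∂μ, ∀ᶠ k : ℕ in atTop, x ∈ S k → μ (S k) ≤ ENNReal.ofReal ((k : ℝ) ^ (-(1 - ε))) := by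
  classical
  set T : ℕ → Set X := fun k =>
    if 1 ≤ k ∧ ENNReal.ofReal ((k : ℝ) ^ (-(1 - ε))) < μ (S k) then S k else ∅ with hT
  have hle : ∀ k, μ (T k) ≤ ENNReal.ofReal ((k : ℝ) ^ (1 - ε)) * μ (S k) ^ 2 := by
    intro k
    simp only [hT]
    split_ifs with hk
    · have hk0 : (0 : ℝ) < k := by exact_mod_cast hk.1
      calc μ (S k) = ENNReal.ofReal ((k : ℝ) ^ (1 - ε)) *
            (ENNReal.ofReal ((k : ℝ) ^ (-(1 - ε))) * μ (S k)) := by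
            rw [← mul_assoc, ← ENNReal.ofReal_mul (by positivity), ← Real.rpow_add hk0]
            simp
        _ ≤ _ := by rw [sq]; gcongr; exact hk.2.le
    · simp
  have hsum : ∑' k, μ (T k) ≠ ∞ := ne_top_of_le_ne_top h (ENNReal.tsum_le_tsum hle)
  filter_upwards [ae_eventually_notMem hsum] with x hx
  filter_upwards [hx, eventually_ge_atTop 1] with k hk hk1 hxS
  by_contra hlt
  exact hk (by rw [hT]; dsimp only; rwa [if_pos ⟨hk1, not_le.1 hlt⟩])

variable {U : Type*} [MetricSpace U] [MeasurableSpace U] [BorelSpace U]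
  [SecondCountableTopology U] {u₀ : U} {lam : ℕ → ℝ} {hlam : ∀ n, 1 ≤ n → 0 < lam n}

/-- By Tonelli the series has finite integral, hence is finite almost everywhere. The absolute value
serves the index 0, where the sign of `lam` is not prescribed. -/
theorem ae_summable_of_tsum_lintegral {μ : Measure (ℕ → U)}
    (hzero : ∀ᵐ x ∂μ, x 0 = u₀) (hlam : ∀ n, 1 ≤ n → 0 < lam n)
    (h : ∑' k, ∫⁻ x, ENNReal.ofReal (|lam k| * dist (x k) u₀) ∂μ ≠ ∞) :
    ∀ᵐ x ∂μ, Summable fun n => lam n * dist (x n) u₀ := by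
  have hmeas : ∀ k, Measurable fun x : ℕ → U => ENNReal.ofReal (|lam k| * dist (x k) u₀) :=
    fun k => (((measurable_pi_apply k).dist measurable_const).const_mul _).ennreal_ofReal
  rw [← lintegral_tsum fun k => (hmeas k).aemeasurable] at h
  filter_upwards [ae_lt_top (Measurable.tsum hmeas) h, hzero] with x hx hx0
  have := ENNReal.summable_toReal hx.ne
  refine this.congr fun k => ?_
  rw [ENNReal.toReal_ofReal (by positivity)]
  rcases Nat.eq_zero_or_pos k with rfl | hk
  · simp [hx0]
  · rw [abs_of_pos (hlam k hk)]

theorem dimBound_le_dimH_leaves {b : ℕ → Block u₀} {K : ℕ → ℕ} {Z : ℕ → U}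
    (μ : Measure (ℕ → U)) [IsProbabilityMeasure μ] {α ε h : ℝ} (hα : 0 < α) (hε : 0 < ε)
    (hε2 : ε < 1 / 2) (hh : 0 < h)
    (hzero : ∀ᵐ x ∂μ, x 0 = u₀)
    (htrunc : ∀ᵐ x ∂μ, ∀ n, 1 ≤ n →
      truncateSeq u₀ n x ∈ EllOne.coord '' glued lam hlam b K Z n)
    (hfar : ∑' j, μ {x | ∀ k ∈ scaleIndices lam α ε j, dist (x k) u₀ < h} ≠ ∞)
    (hmass : ∑' k : ℕ, ENNReal.ofReal ((k : ℝ) ^ (1 - ε)) * μ {x | x k ≠ u₀} ^ 2 ≠ ∞)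
    (hsum : ∑' k, ∫⁻ x, ENNReal.ofReal (|lam k| * dist (x k) u₀) ∂μ ≠ ∞) :
    ENNReal.ofReal (dimBound α ε) ≤ dimH (leaves lam hlam b K Z) := by
  set A : ℕ → Set (ℕ → U) := fun m => {x | x 0 = u₀ ∧
    (Summable fun n => lam n * dist (x n) u₀) ∧
    (∀ n, 1 ≤ n → truncateSeq u₀ n x ∈ EllOne.coord '' glued lam hlam b K Z n) ∧
    (∀ j, m ≤ j → ∃ k ∈ scaleIndices lam α ε j, h ≤ dist (x k) u₀) ∧
    ∀ k : ℕ, m ≤ k → x k ≠ u₀ →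
      μ {y | y k ≠ u₀} ≤ ENNReal.ofReal ((k : ℝ) ^ (-(1 - ε)))} with hA
  -- Almost every point satisfies both Borel–Cantelli conclusions from some index m on, so the
  -- countably many sets A m cover almost everything and one of them is not null.
  have hex : ∃ m, μ (A m) ≠ 0 := by
    by_contra! hall
    have h1 : ∀ᵐ x ∂μ, ∀ m, x ∉ A m := ae_all_iff.2 fun m => measure_eq_zero_iff_ae_notMem.1 (hall m)
    have : ∀ᵐ x ∂μ, False := by
      filter_upwards [h1, hzero, ae_summable_of_tsum_lintegral hzero hlam hsum, htrunc,
        ae_eventually_notMem hfar, ae_eventually_measure_le hmass] with x h1 h2 h3 h4 h5 h6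
      obtain ⟨m, hm⟩ := eventually_atTop.1 (h5.and h6)
      refine h1 m ⟨h2, h3, h4, fun j hj => ?_, fun k hk => (hm k hk).2⟩
      have := (hm j hj).1
      simpa using this
    exact absurd this (by simp [IsProbabilityMeasure.ne_zero μ])
  obtain ⟨m, hm⟩ := hex
  have hs : 0 < dimBound α ε := div_pos (by linarith) (by positivity)
  obtain ⟨j₁, hj₁⟩ := eventually_atTop.1 ((le_scale_of_mem (lam := lam) (α := α) hε).and
    ((tendsto_scale hε).eventually_ge_atTop (m : ℝ)))
  have hscale : Tendsto (fun j => scale ε j ^ (-(α + ε))) atTop (𝓝 0) :=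
    (tendsto_rpow_neg_atTop (by positivity)).comp (tendsto_scale hε)
  have hne : ∀ x ∈ A m, ∀ k, h ≤ dist (x k) u₀ → x k ≠ u₀ := by
    rintro x - k hk h0
    rw [h0, dist_self] at hk
    linarith
  -- A crossed index at scale j satisfies t_j ≤ k ≤ t_{j+2}. The upper bound makes h λ_k at least r
  -- j, and the lower bound makes the subtree mass at most v j.
  refine le_dimH_leaves μ hm (fun x hx => hx.1) (fun x hx => hx.2.1) (fun x hx => hx.2.2.1)
    (fun x hx => ?_) (r := fun j => h * scale ε (j + 2) ^ (-(α + ε)))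
    (v := fun j => scale ε j ^ (-(1 - ε)))
    (fun j => mul_pos hh (Real.rpow_pos_of_pos (scale_pos _ _) _)) ?_
    (s := (dimBound α ε).toNNReal) (Real.toNNReal_pos.2 hs) ?_ (j₀ := max m j₁)
    (fun x hx j hj => ?_)
  · refine frequently_atTop.2 fun n => ?_
    obtain ⟨j, hj, hjm⟩ := ((tendsto_scale hε).eventually_ge_atTop (n : ℝ)).and
      (eventually_ge_atTop m) |>.exists
    obtain ⟨k, hk, hkh⟩ := hx.2.2.2.1 j hjm
    exact ⟨k, by exact_mod_cast hj.trans (scale_le_of_mem hk), hne x hx k hkh⟩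
  · have := ((tendsto_add_atTop_iff_nat 2).2 hscale).const_mul h
    rwa [mul_zero] at this
  · rw [Real.coe_toNNReal _ hs.le]
    -- `dimBound` has 1 - 2ε in its numerator rather than 1 - ε: the spare factor t_j^(-ε) absorbs
    -- the constant h^s.
    have h1 : Tendsto (fun j => scale ε j ^ (-ε)) atTop (𝓝 0) :=
      (tendsto_rpow_neg_atTop hε).comp (tendsto_scale hε)
    filter_upwards [h1.eventually_le_const (Real.rpow_pos_of_pos hh (dimBound α ε))] with j hj
    have hpos := scale_pos ε j
    rw [Real.mul_rpow hh.le (Real.rpow_nonneg (scale_pos _ _).le _), show j + 1 + 2 = j + 3 by ring,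
      scale_add_three, ← Real.rpow_mul hpos.le, ← Real.rpow_mul hpos.le]
    have h2 : (1 + ε) ^ 3 * -(α + ε) * dimBound α ε = -(1 - 2 * ε) := by
      rw [dimBound]
      have : (1 + ε) ^ 3 * (α + ε) ≠ 0 := by positivity
      field_simp
    rw [h2]
    calc scale ε j ^ (-(1 - ε)) = scale ε j ^ (-ε) * scale ε j ^ (-(1 - 2 * ε)) := by
          rw [← Real.rpow_add hpos]; ring_nf
      _ ≤ _ := by gcongr
  · obtain ⟨hj2, hj3⟩ := hj₁ j ((le_max_right _ _).trans hj)
    obtain ⟨k, hk, hkh⟩ := hx.2.2.2.1 j ((le_max_left _ _).trans hj)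
    have hk1 : (0 : ℝ) < k := (scale_pos ε j).trans_le (scale_le_of_mem hk)
    refine ⟨k, ?_, ?_⟩
    · rw [mul_comm]
      refine mul_le_mul ?_ hkh hh.le (hlam k (one_le_of_mem_scaleIndices hk)).le
      refine le_trans ?_ (Finset.mem_filter.1 hk).2
      rw [← neg_add']
      exact Real.rpow_le_rpow_of_nonpos hk1 (hj2 k hk) (by linarith)
    · refine (hx.2.2.2.2 k (by exact_mod_cast hj3.trans (scale_le_of_mem hk))
        (hne x hx k hkh)).trans (ENNReal.ofReal_le_ofReal ?_)
      exact Real.rpow_le_rpow_of_nonpos (scale_pos ε j) (scale_le_of_mem hk) (by linarith)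

end DimensionBound

/-! ### The law of a random point of `𝒯ₙ` -/

section LeafLaw

variable {U : Type*} {u₀ : U}

/-- The coordinates of the point `z` of block `k`, for `q = (k, z)`, when those of the root of
block `k` are `p (k - 1)`. -/
noncomputable def graftPoint (u₀ : U) (p : ℕ → ℕ → U) (n : ℕ) (q : ℕ × U) : ℕ → U :=
  if 1 ≤ q.1 ∧ q.1 ≤ n then Function.update (p (q.1 - 1)) q.1 q.2 else fun _ => u₀

theorem measurable_graftPoint [MeasurableSpace U] {Ω : Type*} [MeasurableSpace Ω]
    {p : Ω → ℕ → ℕ → U} {n : ℕ}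
    (hp : ∀ k, k < n → Measurable fun ω => p ω k) :
    Measurable fun y : Ω × ℕ × U => graftPoint u₀ (p y.1) n y.2 := by
  have h : Measurable fun y : ℕ × Ω × U => graftPoint u₀ (p y.2.1) n (y.1, y.2.2) := by
    refine measurable_from_prod_countable_right fun k => ?_
    by_cases hk : 1 ≤ k ∧ k ≤ n
    · simp only [graftPoint, if_pos hk]
      refine measurable_pi_iff.2 fun i => ?_
      by_cases hi : i = k
      · subst hi
        simpa using measurable_snd
      · simp only [Function.update_of_ne hi]
        exact (measurable_pi_apply i).comp ((hp (k - 1) (by omega)).comp measurable_fst)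
    · simp only [graftPoint, if_neg hk]
      exact measurable_const
  exact h.comp ((measurable_fst.comp measurable_snd).prodMk
    (measurable_fst.prodMk (measurable_snd.comp measurable_snd)))

theorem measurable_graftPoint_right [MeasurableSpace U] (p : ℕ → ℕ → U) (n : ℕ) :
    Measurable (graftPoint u₀ p n) :=
  (measurable_graftPoint (Ω := Unit) (p := fun _ => p) fun _ _ => measurable_const).comp
    (measurable_prodMk_left (x := ()))

variable [MetricSpace U]

/-- The coordinates of `gluePoint`. -/
noncomputable def glueCoord (lam : ℕ → ℝ) (hlam : ∀ n, 1 ≤ n → 0 < lam n) (u₀ : U) (K : ℕ → ℕ)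
    (Z : ℕ → U) (n : ℕ) : ℕ → U :=
  (gluePoint u₀ lam hlam K Z n).coord

variable {lam w : ℕ → ℝ} {hlam : ∀ n, 1 ≤ n → 0 < lam n}

theorem glueCoord_eq (K : ℕ → ℕ) (Z : ℕ → U) (n : ℕ) :
    glueCoord lam hlam u₀ K Z n = graftPoint u₀ (glueCoord lam hlam u₀ K Z) n (K n, Z n) := by
  rw [glueCoord, gluePoint, graftPoint]
  split_ifs <;> rfl

theorem glueCoord_of_lt (K : ℕ → ℕ) (Z : ℕ → U) (n : ℕ) {i : ℕ} (hi : n < i) :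
    glueCoord lam hlam u₀ K Z n i = u₀ :=
  gluePoint_coord_of_lt K Z n hi

theorem glueCoord_zero (K : ℕ → ℕ) (Z : ℕ → U) (i : ℕ) :
    glueCoord lam hlam u₀ K Z 0 i = u₀ := by
  rcases Nat.eq_zero_or_pos i with rfl | hi
  · exact EllOne.coord_zero _
  · exact glueCoord_of_lt K Z 0 hi

variable [MeasurableSpace U]

theorem measurable_glueCoord {Ω : Type*} [MeasurableSpace Ω] {K : ℕ → Ω → ℕ} {Z : ℕ → Ω → U}
    {n : ℕ} (h : ∀ m, 1 ≤ m → m < n → Measurable fun ω => (K m ω, Z m ω)) {k : ℕ} (hk : k < n) :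
    Measurable fun ω => glueCoord lam hlam u₀ (fun m => K m ω) (fun m => Z m ω) k := by
  induction k using Nat.strong_induction_on with
  | _ k ih =>
    rcases Nat.eq_zero_or_pos k with rfl | hk0
    · refine measurable_pi_iff.2 fun i => ?_
      simp only [glueCoord_zero]
      exact measurable_const
    · simp_rw [glueCoord_eq _ _ k]
      exact (measurable_graftPoint (u₀ := u₀) (n := k)
        (p := fun ω => glueCoord lam hlam u₀ (fun m => K m ω) (fun m => Z m ω))
        fun j hj => ih j hj (hj.trans hk)).comp (measurable_id.prodMk (h k hk0 hk))

/-- The law of the coordinates of a random point of the glued blocks `1, …, n`, chosen according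
to the normalised weights. -/
noncomputable def leafLaw (w : ℕ → ℝ) (b : ℕ → Block u₀) (p : ℕ → ℕ → U) (n : ℕ) :
    Measure (ℕ → U) :=
  (graftLaw w b n).map (graftPoint u₀ p n)

theorem lintegral_graftLaw (b : ℕ → Block u₀) (n : ℕ) {f : ℕ × U → ℝ≥0∞} (hf : Measurable f) :
    ∫⁻ q, f q ∂graftLaw w b n = ∑ k ∈ Finset.Icc 1 n,
      ENNReal.ofReal (w k / totalWeight w n) * ∫⁻ z, f (k, z) ∂((b k).ν : Measure U) := by
  rw [graftLaw, lintegral_finsetSum_measure]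
  refine Finset.sum_congr rfl fun k _ => ?_
  rw [lintegral_smul_measure, Measure.dirac_prod, lintegral_map hf measurable_prodMk_left,
    smul_eq_mul]

theorem lintegral_leafLaw_eq (b : ℕ → Block u₀) (p : ℕ → ℕ → U) (n : ℕ) {f : (ℕ → U) → ℝ≥0∞}
    (hf : Measurable f) : ∫⁻ x, f x ∂leafLaw w b p n =
      ∫⁻ q, f (graftPoint u₀ p n q) ∂graftLaw w b n :=
  lintegral_map hf (measurable_graftPoint_right p n)

theorem lintegral_leafLaw (b : ℕ → Block u₀) (p : ℕ → ℕ → U) (n : ℕ) {f : (ℕ → U) → ℝ≥0∞}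
    (hf : Measurable f) : ∫⁻ x, f x ∂leafLaw w b p n = ∑ k ∈ Finset.Icc 1 n,
      ENNReal.ofReal (w k / totalWeight w n) *
        ∫⁻ z, f (Function.update (p (k - 1)) k z) ∂((b k).ν : Measure U) := by
  rw [lintegral_leafLaw_eq b p n hf,
    lintegral_graftLaw (f := fun q => f (graftPoint u₀ p n q)) b n
      (hf.comp (measurable_graftPoint_right p n))]
  refine Finset.sum_congr rfl fun k hk => ?_
  simp [graftPoint, (Finset.mem_Icc.1 hk).1, (Finset.mem_Icc.1 hk).2]

theorem sum_ofReal_div_totalWeight (hw1 : 0 < w 1) (hw : ∀ n, 1 ≤ n → 0 ≤ w n) {n : ℕ}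
    (hn : 1 ≤ n) : ∑ k ∈ Finset.Icc 1 n, ENNReal.ofReal (w k / totalWeight w n) = 1 := by
  rw [← ENNReal.ofReal_sum_of_nonneg fun k hk =>
    div_nonneg (hw k (Finset.mem_Icc.1 hk).1) (totalWeight_nonneg hw n), ← Finset.sum_div]
  have : (∑ k ∈ Finset.Icc 1 n, w k) / totalWeight w n = 1 :=
    div_self (totalWeight_pos hw1 hw hn).ne'
  rw [this, ENNReal.ofReal_one]

theorem isProbabilityMeasure_graftLaw (hw1 : 0 < w 1) (hw : ∀ n, 1 ≤ n → 0 ≤ w n)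
    (b : ℕ → Block u₀) {n : ℕ} (hn : 1 ≤ n) : IsProbabilityMeasure (graftLaw w b n) := by
  refine ⟨?_⟩
  rw [← lintegral_one, lintegral_graftLaw b n measurable_const]
  simpa using sum_ofReal_div_totalWeight hw1 hw hn

theorem isProbabilityMeasure_leafLaw (hw1 : 0 < w 1) (hw : ∀ n, 1 ≤ n → 0 ≤ w n)
    (b : ℕ → Block u₀) (p : ℕ → ℕ → U) {n : ℕ} (hn : 1 ≤ n) :
    IsProbabilityMeasure (leafLaw w b p n) := by
  have := isProbabilityMeasure_graftLaw hw1 hw b hn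
  exact Measure.isProbabilityMeasure_map (measurable_graftPoint_right p n).aemeasurable

theorem leafLaw_zero (b : ℕ → Block u₀) (p : ℕ → ℕ → U) : leafLaw w b p 0 = 0 := by
  simp [leafLaw, graftLaw]

theorem ofReal_div_totalWeight_succ (hw1 : 0 < w 1) (hw : ∀ n, 1 ≤ n → 0 ≤ w n) {n k : ℕ}
    (hk : 1 ≤ k) (hkn : k ≤ n) : ENNReal.ofReal (w k / totalWeight w (n + 1)) =
      ENNReal.ofReal (1 - stepProb w (n + 1)) * ENNReal.ofReal (w k / totalWeight w n) := by
  have h0 := totalWeight_pos hw1 hw (hk.trans hkn)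
  have h1 := totalWeight_pos hw1 hw (show 1 ≤ n + 1 by omega)
  rw [← ENNReal.ofReal_mul (by linarith [stepProb_le_one hw (n + 1)])]
  congr 1
  rw [stepProb, one_sub_div h1.ne', show totalWeight w (n + 1) - w (n + 1) = totalWeight w n by
    rw [totalWeight_succ]; ring]
  field_simp

/-- Adding a block multiplies the old normalised weights by 1 - q_{n+1} and gives weight q_{n+1} to
the new block, rooted at p n. The moment computations are inductions on this recursion; at n = 0 the
old law is the zero measure. -/
theorem lintegral_leafLaw_succ (hw1 : 0 < w 1) (hw : ∀ n, 1 ≤ n → 0 ≤ w n) (b : ℕ → Block u₀)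
    (p : ℕ → ℕ → U) (n : ℕ) {f : (ℕ → U) → ℝ≥0∞} (hf : Measurable f) :
    ∫⁻ x, f x ∂leafLaw w b p (n + 1) =
      ENNReal.ofReal (1 - stepProb w (n + 1)) * ∫⁻ x, f x ∂leafLaw w b p n +
      ENNReal.ofReal (stepProb w (n + 1)) *
        ∫⁻ z, f (Function.update (p n) (n + 1) z) ∂((b (n + 1)).ν : Measure U) := by
  rw [lintegral_leafLaw b p (n + 1) hf, Finset.sum_Icc_succ_top (by omega),
    lintegral_leafLaw b p n hf, Finset.mul_sum]
  congr 1
  refine Finset.sum_congr rfl fun k hk => ?_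
  rw [ofReal_div_totalWeight_succ hw1 hw (Finset.mem_Icc.1 hk).1 (Finset.mem_Icc.1 hk).2, mul_assoc]

/-- A property that holds for all the points of the blocks `1, …, n` holds almost everywhere for
`leafLaw`. -/
theorem leafLaw_compl_eq_zero (b : ℕ → Block u₀) (p : ℕ → ℕ → U) (n : ℕ) {s : Set (ℕ → U)}
    (hs : MeasurableSet s) (h : ∀ k, 1 ≤ k → k ≤ n → ∀ z ∈ (b k).carrier,
      Function.update (p (k - 1)) k z ∈ s) : leafLaw w b p n sᶜ = 0 := by
  rw [← lintegral_indicator_one hs.compl, 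
    lintegral_leafLaw b p n (measurable_one.indicator hs.compl)]
  refine Finset.sum_eq_zero fun k hk => ?_
  obtain ⟨hk1, hkn⟩ := Finset.mem_Icc.1 hk
  rw [mul_eq_zero]
  right
  have : ∀ᵐ z ∂((b k).ν : Measure U), z ∈ (b k).carrier := (b k).ν_compl
  rw [← lintegral_zero (μ := ((b k).ν : Measure U))]
  refine lintegral_congr_ae ?_
  filter_upwards [this] with z hz
  exact indicator_of_notMem (not_not.2 (h k hk1 hkn z hz)) _

end LeafLaw

/-! ### Integration against the conditional law of the grafting points -/

section Disintegration

/-- The conditional probabilities identify the joint law of (Y, X) with the composition product of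
the law of Y and κ on measurable rectangles, hence everywhere. -/
theorem lintegral_eq_of_condProb {Ω Ω' S : Type*} [MeasurableSpace Ω'] [MeasurableSpace S]
    [MeasurableSpace Ω] {P : Measure Ω} [IsProbabilityMeasure P] {Y : Ω → Ω'} (hY : Measurable Y)
    {X : Ω → S} (hX : Measurable X) (κ : Kernel Ω' S) [IsMarkovKernel κ]
    (h : ∀ A, MeasurableSet A → P⟦X ⁻¹' A | MeasurableSpace.comap Y inferInstance⟧
      =ᵐ[P] fun ω => (κ (Y ω)).real A) {F : Ω' × S → ℝ≥0∞} (hF : Measurable F) :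
    ∫⁻ ω, F (Y ω, X ω) ∂P = ∫⁻ ω, ∫⁻ s, F (Y ω, s) ∂κ (Y ω) ∂P := by
  have := Measure.isProbabilityMeasure_map (μ := P) hY.aemeasurable
  have key : P.map (fun ω => (Y ω, X ω)) = (P.map Y) ⊗ₘ κ := by
    refine Measure.ext_prod fun {s t} hs ht => ?_
    rw [Measure.map_apply (hY.prodMk hX) (hs.prod ht), Measure.compProd_apply_prod hs ht,
      setLIntegral_map hs (κ.measurable_coe ht) hY, mk_preimage_prod]
    have hle : MeasurableSpace.comap Y inferInstance ≤ (inferInstance : MeasurableSpace Ω) :=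
      hY.comap_le
    have h1 : ∫ ω in Y ⁻¹' s, (P⟦X ⁻¹' t | MeasurableSpace.comap Y inferInstance⟧) ω ∂P =
        ∫ ω in Y ⁻¹' s, (X ⁻¹' t).indicator (fun _ => (1 : ℝ)) ω ∂P :=
      setIntegral_condExp hle ((integrable_const 1).indicator (hX ht)) ⟨s, hs, rfl⟩
    have h2 : ∫ ω in Y ⁻¹' s, (κ (Y ω)).real t ∂P = P.real (Y ⁻¹' s ∩ X ⁻¹' t) := by
      rw [← integral_congr_ae (ae_restrict_of_ae (h t ht)), h1,
        integral_indicator_const _ (hX ht), measureReal_restrict_apply (hX ht), smul_eq_mul,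
        mul_one, inter_comm]
    have hmeas : Measurable fun ω => κ (Y ω) t := (κ.measurable_coe ht).comp hY
    have h3 : ∫ ω in Y ⁻¹' s, (κ (Y ω)).real t ∂P =
        (∫⁻ ω in Y ⁻¹' s, κ (Y ω) t ∂P).toReal :=
      integral_toReal hmeas.aemeasurable (Eventually.of_forall fun ω => measure_lt_top _ _)
    have h4 : ∫⁻ ω in Y ⁻¹' s, κ (Y ω) t ∂P ≠ ∞ := by
      refine ne_top_of_le_ne_top (measure_ne_top P (Y ⁻¹' s)) ?_
      calc ∫⁻ ω in Y ⁻¹' s, κ (Y ω) t ∂P ≤ ∫⁻ ω in Y ⁻¹' s, 1 ∂P :=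
            lintegral_mono fun ω => prob_le_one
        _ = P (Y ⁻¹' s) := by simp
    rw [h2, measureReal_def] at h3
    exact (ENNReal.toReal_eq_toReal_iff' (measure_ne_top _ _) h4).1 h3
  rw [← lintegral_map (f := F) hF (hY.prodMk hX), key, Measure.lintegral_compProd hF,
    lintegral_map hF.lintegral_kernel_prod_right' hY]

variable {U : Type*} [MetricSpace U] [MeasurableSpace U] {u₀ : U}

theorem measurable_block_ν : Measurable fun c : Block u₀ => (c.ν : Measure U) := by
  refine measurable_subtype_coe.comp (measurable_iff_comap_le.2 ?_)
  exact le_sup_right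

section Kernel

variable {Ω : Type*} [MeasurableSpace Ω] {B : ℕ → Ω → Block u₀}

theorem measurable_lintegral_block (hB : ∀ k, 1 ≤ k → Measurable (B k)) {k : ℕ} (hk : 1 ≤ k)
    {f : U → ℝ≥0∞} (hf : Measurable f) :
    Measurable fun ω => ∫⁻ z, f z ∂((B k ω).ν : Measure U) :=
  (Measure.measurable_lintegral hf).comp (measurable_block_ν.comp (hB k hk))

/-- `graftLaw` as a Markov kernel. -/
noncomputable def graftKernel (w : ℕ → ℝ) (hB : ∀ k, 1 ≤ k → Measurable (B k)) (n : ℕ) :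
    Kernel Ω (ℕ × U) where
  toFun ω := graftLaw w (fun k => B k ω) n
  measurable' := by
    refine Measure.measurable_of_measurable_coe _ fun s hs => ?_
    simp_rw [← lintegral_indicator_one hs, lintegral_graftLaw _ n (measurable_one.indicator hs)]
    refine Finset.measurable_fun_sum _ fun k hk => Measurable.const_mul ?_ _
    exact measurable_lintegral_block hB (Finset.mem_Icc.1 hk).1
      ((measurable_one.indicator hs).comp measurable_prodMk_left)

theorem measurable_lintegral_leafLaw {w : ℕ → ℝ} (hw1 : 0 < w 1) (hw : ∀ n, 1 ≤ n → 0 ≤ w n)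
    (hB : ∀ k, 1 ≤ k → Measurable (B k)) {p : Ω → ℕ → ℕ → U} {n : ℕ}
    (hp : ∀ k, k < n → Measurable fun ω => p ω k) {f : (ℕ → U) → ℝ≥0∞} (hf : Measurable f) :
    Measurable fun ω => ∫⁻ x, f x ∂leafLaw w (fun k => B k ω) (p ω) n := by
  rcases Nat.eq_zero_or_pos n with rfl | hn
  · simp only [leafLaw_zero, lintegral_zero_measure]
    exact measurable_const
  have : IsMarkovKernel (graftKernel w hB n) :=
    ⟨fun ω => isProbabilityMeasure_graftLaw hw1 hw _ hn⟩
  simp_rw [lintegral_leafLaw_eq _ _ n hf]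
  exact Measurable.lintegral_kernel_prod_right' (κ := graftKernel w hB n)
    (f := fun y => f (graftPoint u₀ (p y.1) n y.2)) (hf.comp (measurable_graftPoint hp))

end Kernel

variable {Ω : Type*} {w : ℕ → ℝ} {B : ℕ → Ω → Block u₀} {K : ℕ → Ω → ℕ} {Z : ℕ → Ω → U}

theorem measurable_block_past (K : ℕ → Ω → ℕ) (Z : ℕ → Ω → U) (n : ℕ) {k : ℕ} (hk : 1 ≤ k) :
    Measurable[pastSigma B K Z n] (B k) := by
  refine measurable_iff_comap_le.2 (le_trans ?_ le_sup_left)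
  exact le_iSup₂_of_le k hk le_rfl

theorem measurable_graft_past (B : ℕ → Ω → Block u₀) (K : ℕ → Ω → ℕ) (Z : ℕ → Ω → U) {n m : ℕ}
    (hm : 1 ≤ m) (hmn : m < n) :
    Measurable[pastSigma B K Z n] fun ω => (K m ω, Z m ω) := by
  refine measurable_iff_comap_le.2 (le_trans ?_ le_sup_right)
  exact le_iSup₂_of_le m ⟨hm, hmn⟩ le_rfl

theorem pastSigma_mono (B : ℕ → Ω → Block u₀) (K : ℕ → Ω → ℕ) (Z : ℕ → Ω → U) {m n : ℕ}
    (hmn : m ≤ n) : pastSigma B K Z m ≤ pastSigma B K Z n :=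
  sup_le le_sup_left (le_trans (iSup₂_le fun i hi => by
    exact le_iSup₂_of_le (f := fun (i : ℕ) (_ : 1 ≤ i ∧ i < n) =>
      MeasurableSpace.comap (fun ω => (K i ω, Z i ω)) inferInstance) i
      ⟨hi.1, hi.2.trans_le hmn⟩ le_rfl) le_sup_right)

variable {lam : ℕ → ℝ} {hlam : ∀ n, 1 ≤ n → 0 < lam n}

/-- The coordinates of the gluing points, as random variables. -/
noncomputable def randomCoord {U : Type*} [MetricSpace U] (lam : ℕ → ℝ)
    (hlam : ∀ n, 1 ≤ n → 0 < lam n) (u₀ : U)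
    (K : ℕ → Ω → ℕ) (Z : ℕ → Ω → U) (ω : Ω) : ℕ → ℕ → U :=
  glueCoord lam hlam u₀ (fun m => K m ω) (fun m => Z m ω)

theorem randomCoord_of_lt {U : Type*} [MetricSpace U] {u₀ : U} (K : ℕ → Ω → ℕ) (Z : ℕ → Ω → U)
    (ω : Ω) {n i : ℕ} (hi : n < i) :
    randomCoord lam hlam u₀ K Z ω n i = u₀ :=
  glueCoord_of_lt _ _ n hi

theorem measurable_randomCoord_past (B : ℕ → Ω → Block u₀) (K : ℕ → Ω → ℕ) (Z : ℕ → Ω → U)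
    {n k : ℕ} (hk : k < n) :
    Measurable[pastSigma B K Z n] fun ω => randomCoord lam hlam u₀ K Z ω k :=
  @measurable_glueCoord U u₀ _ lam hlam _ Ω (pastSigma B K Z n) K Z n
    (fun _ h1 h2 => measurable_graft_past B K Z h1 h2) k hk

/-- The random measure `leafLaw`. -/
noncomputable def randomLeafLaw (lam : ℕ → ℝ) (hlam : ∀ n, 1 ≤ n → 0 < lam n) (w : ℕ → ℝ)
    (B : ℕ → Ω → Block u₀) (K : ℕ → Ω → ℕ) (Z : ℕ → Ω → U) (n : ℕ) (ω : Ω) : Measure (ℕ → U) :=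
  leafLaw w (fun k => B k ω) (randomCoord lam hlam u₀ K Z ω) n

theorem measurable_lintegral_randomLeafLaw (hw1 : 0 < w 1) (hw : ∀ n, 1 ≤ n → 0 ≤ w n) (n : ℕ)
    {f : (ℕ → U) → ℝ≥0∞} (hf : Measurable f) :
    Measurable[pastSigma B K Z n] fun ω => ∫⁻ x, f x ∂randomLeafLaw lam hlam w B K Z n ω :=
  @measurable_lintegral_leafLaw U _ _ u₀ Ω (pastSigma B K Z n) B w hw1 hw
    (fun _ hk => measurable_block_past K Z n hk) (randomCoord lam hlam u₀ K Z) n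
    (fun _ hk => measurable_randomCoord_past B K Z hk) f hf

theorem measurable_randomLeafLaw_apply (hw1 : 0 < w 1) (hw : ∀ n, 1 ≤ n → 0 ≤ w n) (n : ℕ)
    {s : Set (ℕ → U)} (hs : MeasurableSet s) :
    Measurable[pastSigma B K Z n] fun ω => randomLeafLaw lam hlam w B K Z n ω s := by
  simp_rw [← lintegral_indicator_one hs]
  exact measurable_lintegral_randomLeafLaw hw1 hw n (measurable_one.indicator hs)

variable [mΩ : MeasurableSpace Ω] {P : Measure Ω}

theorem IsRandomGluing.pastSigma_le (h : IsRandomGluing P w B K Z) (n : ℕ) :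
    pastSigma B K Z n ≤ mΩ :=
  sup_le (iSup₂_le fun j hj => (h.measurable_block j hj).comap_le)
    (iSup₂_le fun m hm => (h.measurable_graft m hm.1).comap_le)

variable [IsProbabilityMeasure P]

theorem IsRandomGluing.lintegral_graft (h : IsRandomGluing P w B K Z) (hw1 : 0 < w 1)
    (hw : ∀ n, 1 ≤ n → 0 ≤ w n) {n : ℕ} (hn : 1 ≤ n) {F : Ω × ℕ × U → ℝ≥0∞}
    (hF : Measurable[(pastSigma B K Z n).prod inferInstance] F) :
    ∫⁻ ω, F (ω, K n ω, Z n ω) ∂P = ∫⁻ ω, ∫⁻ q, F (ω, q) ∂graftLaw w (fun k => B k ω) n ∂P := by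
  have hB : ∀ k, 1 ≤ k → Measurable[pastSigma B K Z n] (B k) :=
    fun k hk => measurable_block_past K Z n hk
  have : @IsMarkovKernel _ _ (pastSigma B K Z n) _
      (@graftKernel U _ _ u₀ Ω (pastSigma B K Z n) B w hB n) :=
    @IsMarkovKernel.mk _ _ (pastSigma B K Z n) _ _
      fun ω => isProbabilityMeasure_graftLaw hw1 hw _ hn
  -- The conditioning variable is the identity from Ω to Ω equipped with the smaller σ-algebra of
  -- the past.
  refine @lintegral_eq_of_condProb Ω Ω (ℕ × U) (pastSigma B K Z n) _ mΩ P _ id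
    (measurable_id'' (h.pastSigma_le n)) (fun ω => (K n ω, Z n ω)) (h.measurable_graft n hn)
    (@graftKernel U _ _ u₀ Ω (pastSigma B K Z n) B w hB n) this (fun A hA => ?_) F hF
  rw [MeasurableSpace.comap_id]
  exact h.graft_law n hn A hA

/-- Given the past, the gluing point `X n` has law `randomLeafLaw n`. -/
theorem IsRandomGluing.lintegral_mul_randomCoord (h : IsRandomGluing P w B K Z) (hw1 : 0 < w 1)
    (hw : ∀ n, 1 ≤ n → 0 ≤ w n) {n : ℕ} (hn : 1 ≤ n) {c : Ω → ℝ≥0∞}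
    (hc : Measurable[pastSigma B K Z n] c) {f : (ℕ → U) → ℝ≥0∞} (hf : Measurable f) :
    ∫⁻ ω, c ω * f (randomCoord lam hlam u₀ K Z ω n) ∂P =
      ∫⁻ ω, c ω * ∫⁻ x, f x ∂randomLeafLaw lam hlam w B K Z n ω ∂P := by
  have hg : Measurable[(pastSigma B K Z n).prod inferInstance] fun y : Ω × ℕ × U =>
      graftPoint u₀ (randomCoord lam hlam u₀ K Z y.1) n y.2 :=
    @measurable_graftPoint U u₀ _ Ω (pastSigma B K Z n) (randomCoord lam hlam u₀ K Z) n
      fun _ hk => measurable_randomCoord_past B K Z hk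
  have hF : Measurable[(pastSigma B K Z n).prod inferInstance] fun y : Ω × ℕ × U =>
      c y.1 * f (graftPoint u₀ (randomCoord lam hlam u₀ K Z y.1) n y.2) :=
    (hc.comp (@measurable_fst _ _ (pastSigma B K Z n) _)).mul (hf.comp hg)
  have := h.lintegral_graft hw1 hw hn hF
  simp only [randomCoord] at this ⊢
  simp_rw [glueCoord_eq _ _ n]
  rw [this]
  refine lintegral_congr fun ω => ?_
  rw [lintegral_const_mul (f := fun q => f (graftPoint u₀ _ n q)) _
    (hf.comp (measurable_graftPoint_right _ n)), randomLeafLaw, lintegral_leafLaw_eq _ _ n hf]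
  rfl

end Disintegration

/-! ### Moments of the masses -/

section Moments

theorem measurable_coord_prod {U : Type*} [MeasurableSpace U] (J : Finset ℕ) {f : ℕ → U → ℝ≥0∞} (hf : ∀ i, Measurable (f i)) :
    Measurable fun x : ℕ → U => ∏ i ∈ J, f i (x i) :=
  Finset.measurable_fun_prod J fun i _ => (hf i).comp (measurable_pi_apply i)

variable {U : Type*} [MetricSpace U] [MeasurableSpace U] {u₀ : U}
  {lam w : ℕ → ℝ} {hlam : ∀ n, 1 ≤ n → 0 < lam n}

/-- The mean of `f (x i)` under the law, given the blocks, of a random point of `𝒯ₙ`. -/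
noncomputable def coordMean (w : ℕ → ℝ) (b : ℕ → Block u₀) (n i : ℕ) (f : U → ℝ≥0∞) : ℝ≥0∞ :=
  if 1 ≤ i ∧ i ≤ n then ENNReal.ofReal (1 - stepProb w i) * f u₀ +
    ENNReal.ofReal (stepProb w i) * ∫⁻ z, f z ∂((b i).ν : Measure U) else f u₀

theorem coordMean_succ_of_ne (b : ℕ → Block u₀) {n i : ℕ} (hi : i ≠ n + 1) (f : U → ℝ≥0∞) :
    coordMean w b (n + 1) i f = coordMean w b n i f := by
  have : (1 ≤ i ∧ i ≤ n + 1) ↔ (1 ≤ i ∧ i ≤ n) := by omega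
  simp only [coordMean, this]

theorem ofReal_one_sub_add_ofReal_stepProb (hw : ∀ n, 1 ≤ n → 0 ≤ w n) (n : ℕ) :
    ENNReal.ofReal (1 - stepProb w n) + ENNReal.ofReal (stepProb w n) = 1 := by
  rw [← ENNReal.ofReal_add (by linarith [stepProb_le_one hw n]) (stepProb_nonneg hw n)]
  simp

theorem stepProb_one (hw1 : 0 < w 1) : stepProb w 1 = 1 := by
  simp [stepProb, totalWeight, hw1.ne']

variable {Ω : Type*} [mΩ : MeasurableSpace Ω] {P : Measure Ω}
  {B : ℕ → Ω → Block u₀} {K : ℕ → Ω → ℕ} {Z : ℕ → Ω → U}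

theorem lintegral_block_eq (h : IsRandomGluing P w B K Z) {k : ℕ} (hk : 1 ≤ k) {f : U → ℝ≥0∞}
    (hf : Measurable f) : ∫⁻ ω, ∫⁻ z, f z ∂((B k ω).ν : Measure U) ∂P =
      ∫⁻ ω, ∫⁻ z, f z ∂((B 1 ω).ν : Measure U) ∂P :=
  ((h.identDistrib_block k hk).comp
    ((Measure.measurable_lintegral hf).comp measurable_block_ν)).lintegral_eq

variable [IsProbabilityMeasure P]

/-- Given the blocks, the coordinates of a random point of `𝒯ₙ` are independent. -/
theorem IsRandomGluing.lintegral_prod_coord (h : IsRandomGluing P w B K Z) (hw1 : 0 < w 1)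
    (hw : ∀ n, 1 ≤ n → 0 ≤ w n) {f : ℕ → U → ℝ≥0∞} (hf : ∀ i, Measurable (f i)) {n : ℕ}
    (hn : 1 ≤ n) (J : Finset ℕ) {c : Ω → ℝ≥0∞} (hc : Measurable[pastSigma B K Z 1] c) :
    ∫⁻ ω, c ω * ∫⁻ x, ∏ i ∈ J, f i (x i) ∂randomLeafLaw lam hlam w B K Z n ω ∂P =
      ∫⁻ ω, c ω * ∏ i ∈ J, coordMean w (fun k => B k ω) n i (f i) ∂P := by
  have hle := h.pastSigma_le
  -- the induction step
  have step : ∀ n, (1 ≤ n → ∀ (J : Finset ℕ) (c : Ω → ℝ≥0∞), Measurable[pastSigma B K Z 1] c →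
      ∫⁻ ω, c ω * ∫⁻ x, ∏ i ∈ J, f i (x i) ∂randomLeafLaw lam hlam w B K Z n ω ∂P =
        ∫⁻ ω, c ω * ∏ i ∈ J, coordMean w (fun k => B k ω) n i (f i) ∂P) →
      ∀ (J : Finset ℕ) (c : Ω → ℝ≥0∞), Measurable[pastSigma B K Z 1] c →
      ∫⁻ ω, c ω * ∫⁻ x, ∏ i ∈ J, f i (x i) ∂randomLeafLaw lam hlam w B K Z (n + 1) ω ∂P =
        ∫⁻ ω, c ω * ∏ i ∈ J, coordMean w (fun k => B k ω) (n + 1) i (f i) ∂P := by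
    intro n ih J c hc
    -- the coordinates of the `n`-th gluing point
    have hglue : ∀ (J : Finset ℕ) (c : Ω → ℝ≥0∞), Measurable[pastSigma B K Z 1] c →
        ∫⁻ ω, c ω * ∏ i ∈ J, f i (randomCoord lam hlam u₀ K Z ω n i) ∂P =
          ∫⁻ ω, c ω * ∏ i ∈ J, coordMean w (fun k => B k ω) n i (f i) ∂P := by
      intro J c hc
      -- The point X 0 is the root, not a random graft: all its coordinates are u₀, in agreement
      -- with `coordMean` at n = 0. For n ≥ 1, given the past, X n has the law `randomLeafLaw` and
      -- the induction hypothesis applies.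
      rcases Nat.eq_zero_or_pos n with rfl | hn
      · refine lintegral_congr fun ω => ?_
        congr 1
        refine Finset.prod_congr rfl fun i _ => ?_
        rw [coordMean, if_neg (by omega), randomCoord, glueCoord_zero]
      · rw [← ih hn J c hc]
        exact h.lintegral_mul_randomCoord hw1 hw hn (hc.mono (pastSigma_mono B K Z hn) le_rfl)
          (measurable_coord_prod J hf)
    have hfirst : ∀ (J : Finset ℕ) (c : Ω → ℝ≥0∞), Measurable[pastSigma B K Z 1] c →
        ENNReal.ofReal (1 - stepProb w (n + 1)) *
          ∫⁻ ω, c ω * ∫⁻ x, ∏ i ∈ J, f i (x i) ∂randomLeafLaw lam hlam w B K Z n ω ∂P =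
        ENNReal.ofReal (1 - stepProb w (n + 1)) *
          ∫⁻ ω, c ω * ∏ i ∈ J, coordMean w (fun k => B k ω) n i (f i) ∂P := by
      intro J c hc
      -- At n = 0 no induction hypothesis is available, but the factor 1 - q_1 vanishes.
      rcases Nat.eq_zero_or_pos n with rfl | hn
      · simp [stepProb_one hw1]
      · rw [ih hn J c hc]
    have hB : ∀ k, 1 ≤ k → Measurable[pastSigma B K Z 1] (B k) :=
      fun k hk => measurable_block_past K Z 1 hk
    have hmean : ∀ i, Measurable[pastSigma B K Z 1] fun ω =>
        ∫⁻ z, f (i + 1) z ∂((B (i + 1) ω).ν : Measure U) := fun i =>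
      @measurable_lintegral_block U _ _ u₀ Ω (pastSigma B K Z 1) B hB (i + 1) (by omega) _ (hf _)
    have hX : ∀ (J : Finset ℕ) (c : Ω → ℝ≥0∞), Measurable[pastSigma B K Z 1] c →
        Measurable fun ω => c ω *
          ∫⁻ x, ∏ i ∈ J, f i (x i) ∂randomLeafLaw lam hlam w B K Z n ω := fun J c hc =>
      (hc.mono (hle 1) le_rfl).mul ((measurable_lintegral_randomLeafLaw hw1 hw n
        (measurable_coord_prod J hf)).mono (hle n) le_rfl)
    have hrec : ∀ ω, c ω * ∫⁻ x, ∏ i ∈ J, f i (x i) ∂randomLeafLaw lam hlam w B K Z (n + 1) ω =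
        ENNReal.ofReal (1 - stepProb w (n + 1)) *
          (c ω * ∫⁻ x, ∏ i ∈ J, f i (x i) ∂randomLeafLaw lam hlam w B K Z n ω) +
        ENNReal.ofReal (stepProb w (n + 1)) * (c ω *
          ∫⁻ z, ∏ i ∈ J, f i (Function.update (randomCoord lam hlam u₀ K Z ω n) (n + 1) z i)
            ∂((B (n + 1) ω).ν : Measure U)) := by
      intro ω
      rw [randomLeafLaw, lintegral_leafLaw_succ hw1 hw _ _ n (measurable_coord_prod J hf),
        randomLeafLaw]
      ring
    simp_rw [hrec]
    rw [lintegral_add_left ((hX J c hc).const_mul _), lintegral_const_mul' _ _ ENNReal.ofReal_ne_top,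
      lintegral_const_mul' _ _ ENNReal.ofReal_ne_top, hfirst J c hc]
    -- If n + 1 ∈ J, the new factor integrates to a function of the blocks alone and is absorbed
    -- into c, which is why the statement carries a general weight c. Otherwise the new block does
    -- not affect the integrand, and the two contributions recombine through (1 - q) + q = 1.
    by_cases hJ : n + 1 ∈ J
    · obtain ⟨J', hJ', rfl⟩ : ∃ J', n + 1 ∉ J' ∧ insert (n + 1) J' = J :=
        ⟨J.erase (n + 1), Finset.notMem_erase _ _, Finset.insert_erase hJ⟩
      have hne : ∀ i ∈ J', i ≠ n + 1 := fun i hi h => hJ' (h ▸ hi)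
      have h1 : ∀ ω, c ω * ∫⁻ z, ∏ i ∈ insert (n + 1) J',
          f i (Function.update (randomCoord lam hlam u₀ K Z ω n) (n + 1) z i)
            ∂((B (n + 1) ω).ν : Measure U) =
          (c ω * ∫⁻ z, f (n + 1) z ∂((B (n + 1) ω).ν : Measure U)) *
            ∏ i ∈ J', f i (randomCoord lam hlam u₀ K Z ω n i) := by
        intro ω
        rw [mul_assoc, ← lintegral_mul_const _ (hf _)]
        congr 1
        refine lintegral_congr fun z => ?_
        rw [Finset.prod_insert hJ', Function.update_self]
        congr 1
        exact Finset.prod_congr rfl fun i hi => by rw [Function.update_of_ne (hne i hi)]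
      simp_rw [h1]
      rw [hglue J' (fun ω => c ω * ∫⁻ z, f (n + 1) z ∂((B (n + 1) ω).ν : Measure U))
          (hc.mul (hmean n)), ← lintegral_const_mul' _ _ ENNReal.ofReal_ne_top,
        ← lintegral_const_mul' _ _ ENNReal.ofReal_ne_top, ← lintegral_add_left]
      · refine lintegral_congr fun ω => ?_
        rw [Finset.prod_insert hJ', Finset.prod_insert hJ',
          Finset.prod_congr rfl fun i hi => coordMean_succ_of_ne _ (hne i hi) (f i), coordMean,
          if_neg (by omega), coordMean, if_pos (by omega)]
        ring
      · refine ((hc.mono (hle 1) le_rfl).mul (Finset.measurable_fun_prod _ fun i _ => ?_)).const_mul _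
        unfold coordMean
        split_ifs with hi
        · exact ((measurable_lintegral_block h.measurable_block hi.1 (hf i)).const_mul _).const_add _
        · exact measurable_const
    · have hne : ∀ i ∈ J, i ≠ n + 1 := fun i hi h => hJ (h ▸ hi)
      have h1 : ∀ ω, c ω * ∫⁻ z, ∏ i ∈ J,
          f i (Function.update (randomCoord lam hlam u₀ K Z ω n) (n + 1) z i)
            ∂((B (n + 1) ω).ν : Measure U) =
          c ω * ∏ i ∈ J, f i (randomCoord lam hlam u₀ K Z ω n i) := by
        intro ω
        congr 1
        rw [lintegral_congr (g := fun _ => ∏ i ∈ J, f i (randomCoord lam hlam u₀ K Z ω n i))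
          fun z => Finset.prod_congr rfl fun i hi => by rw [Function.update_of_ne (hne i hi)]]
        simp
      simp_rw [h1]
      rw [hglue J c hc, ← add_mul, ofReal_one_sub_add_ofReal_stepProb hw, one_mul]
      refine lintegral_congr fun ω => ?_
      congr 1
      exact Finset.prod_congr rfl fun i hi => (coordMean_succ_of_ne _ (hne i hi) (f i)).symm
  induction n, hn using Nat.le_induction generalizing J c with
  | base => exact step 0 (by omega) J c hc
  | succ n hn ih => exact step n (fun _ J c hc => ih J hc) J c hc

/-- The mean of a function of one coordinate. -/
theorem IsRandomGluing.lintegral_coord_le (h : IsRandomGluing P w B K Z) (hw1 : 0 < w 1)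
    (hw : ∀ n, 1 ≤ n → 0 ≤ w n) {f : U → ℝ≥0∞} (hf : Measurable f) (hf0 : f u₀ = 0) {n : ℕ}
    (hn : 1 ≤ n) (k : ℕ) :
    ∫⁻ ω, ∫⁻ x, f (x k) ∂randomLeafLaw lam hlam w B K Z n ω ∂P ≤
      ENNReal.ofReal (stepProb w k) * ∫⁻ ω, ∫⁻ z, f z ∂((B 1 ω).ν : Measure U) ∂P := by
  have := h.lintegral_prod_coord (lam := lam) (hlam := hlam) hw1 hw (fun _ => hf) hn {k}
    (c := fun _ => 1) measurable_const
  simp only [one_mul, Finset.prod_singleton] at this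
  rw [this]
  simp only [coordMean, hf0, mul_zero, zero_add]
  split_ifs with hk
  · rw [lintegral_const_mul' _ _ ENNReal.ofReal_ne_top, lintegral_block_eq h hk.1 hf]
  · simp

end Moments

/-! ### Moments of subtree masses and probabilities of small heights. -/

section MassMoments

variable {U : Type*} [MetricSpace U] [MeasurableSpace U] [BorelSpace U] {u₀ : U}
  {lam w : ℕ → ℝ} {hlam : ∀ n, 1 ≤ n → 0 < lam n}

theorem measurableSet_coord_eq (u₀ : U) (k : ℕ) : MeasurableSet {x : ℕ → U | x k = u₀} :=
  (measurable_pi_apply (X := fun _ => U) k) (measurableSet_singleton u₀)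

theorem measurableSet_coord_ne (u₀ : U) (k : ℕ) : MeasurableSet {x : ℕ → U | x k ≠ u₀} :=
  (measurableSet_coord_eq u₀ k).compl

theorem leafLaw_coord_ne_of_lt (b : ℕ → Block u₀) {p : ℕ → ℕ → U}
    (hp : ∀ n i, n < i → p n i = u₀) {n k : ℕ} (hk : n < k) :
    leafLaw w b p n {x | x k ≠ u₀} = 0 := by
  refine leafLaw_compl_eq_zero b p n (s := {x | x k = u₀})
    (measurableSet_coord_eq u₀ k) fun j _ hjn z _ => ?_
  rw [mem_ofPred_eq, Function.update_of_ne (by omega)]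
  exact hp _ _ (by omega)

theorem leafLaw_coord_ne_self_le (hw1 : 0 < w 1) (hw : ∀ n, 1 ≤ n → 0 ≤ w n) (b : ℕ → Block u₀)
    {p : ℕ → ℕ → U} (hp : ∀ n i, n < i → p n i = u₀) {k : ℕ} (hk : 1 ≤ k) :
    leafLaw w b p k {x | x k ≠ u₀} ≤ ENNReal.ofReal (stepProb w k) := by
  obtain ⟨k, rfl⟩ : ∃ j, k = j + 1 := ⟨k - 1, by omega⟩
  have hS := measurableSet_coord_ne u₀ (k + 1)
  rw [← lintegral_indicator_one hS, lintegral_leafLaw_succ hw1 hw b p k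
    (measurable_one.indicator hS), lintegral_indicator_one hS,
    leafLaw_coord_ne_of_lt b hp k.lt_succ_self, mul_zero, zero_add]
  refine mul_le_of_le_one_right zero_le ?_
  refine (lintegral_mono (g := fun _ => 1) fun z => ?_).trans (by simp)
  exact indicator_le_self _ _ _

theorem leafLaw_coord_ne_succ (hw1 : 0 < w 1) (hw : ∀ n, 1 ≤ n → 0 ≤ w n) (b : ℕ → Block u₀)
    (p : ℕ → ℕ → U) {n k : ℕ} (hk : k ≤ n) :
    leafLaw w b p (n + 1) {x | x k ≠ u₀} =
      ENNReal.ofReal (1 - stepProb w (n + 1)) * leafLaw w b p n {x | x k ≠ u₀} +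
      ENNReal.ofReal (stepProb w (n + 1)) * {x | x k ≠ u₀}.indicator 1 (p n) := by
  have hS := measurableSet_coord_ne u₀ k
  rw [← lintegral_indicator_one hS, lintegral_leafLaw_succ hw1 hw b p n
    (measurable_one.indicator hS), lintegral_indicator_one hS]
  have : ∀ z, ({x : ℕ → U | x k ≠ u₀}.indicator (1 : (ℕ → U) → ℝ≥0∞))
      (Function.update (p n) (n + 1) z) = {x : ℕ → U | x k ≠ u₀}.indicator 1 (p n) := by
    intro z
    by_cases hx : p n k = u₀ <;> simp [indicator, Function.update_of_ne (show k ≠ n + 1 by omega), hx]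
  simp [this]

variable {Ω : Type*} [mΩ : MeasurableSpace Ω] {P : Measure Ω} [IsProbabilityMeasure P]
  {B : ℕ → Ω → Block u₀} {K : ℕ → Ω → ℕ} {Z : ℕ → Ω → U}

theorem IsRandomGluing.lintegral_coord_ne_le (h : IsRandomGluing P w B K Z) (hw1 : 0 < w 1)
    (hw : ∀ n, 1 ≤ n → 0 ≤ w n) {n : ℕ} (hn : 1 ≤ n) (k : ℕ) :
    ∫⁻ ω, randomLeafLaw lam hlam w B K Z n ω {x | x k ≠ u₀} ∂P ≤
      ENNReal.ofReal (stepProb w k) := by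
  have hS : MeasurableSet {z : U | z ≠ u₀} := (measurableSet_singleton u₀).compl
  have := h.lintegral_coord_le (lam := lam) (hlam := hlam) hw1 hw
    (f := {z : U | z ≠ u₀}.indicator 1) (measurable_one.indicator hS) (by simp) hn k
  calc ∫⁻ ω, randomLeafLaw lam hlam w B K Z n ω {x | x k ≠ u₀} ∂P
      = ∫⁻ ω, ∫⁻ x, {z : U | z ≠ u₀}.indicator 1 (x k) ∂randomLeafLaw lam hlam w B K Z n ω ∂P := by
        refine lintegral_congr fun ω => ?_
        rw [← lintegral_indicator_one (measurableSet_coord_ne u₀ k)]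
        rfl
    _ ≤ _ := this
    _ ≤ ENNReal.ofReal (stepProb w k) * 1 := by
        gcongr
        calc ∫⁻ ω, ∫⁻ z, {z : U | z ≠ u₀}.indicator 1 z ∂((B 1 ω).ν : Measure U) ∂P
            ≤ ∫⁻ _, 1 ∂P := lintegral_mono fun ω => by
              rw [lintegral_indicator_one hS]; exact prob_le_one
          _ = 1 := by simp
    _ = _ := mul_one _

/-- The second moment of the mass of the points with a nontrivial `k`-th coordinate. -/
theorem IsRandomGluing.lintegral_coord_ne_sq_le_sum (h : IsRandomGluing P w B K Z) (hw1 : 0 < w 1)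
    (hw : ∀ n, 1 ≤ n → 0 ≤ w n) {k n : ℕ} (hk : 1 ≤ k) (hkn : k ≤ n) :
    ∫⁻ ω, randomLeafLaw lam hlam w B K Z n ω {x | x k ≠ u₀} ^ 2 ∂P ≤
      ENNReal.ofReal (stepProb w k) ^ 2 + ENNReal.ofReal (stepProb w k) *
        ∑ i ∈ Finset.Ioc k n, ENNReal.ofReal (stepProb w i) ^ 2 := by
  induction n, hkn using Nat.le_induction with
  | base =>
    simp only [Finset.Ioc_self, Finset.sum_empty, mul_zero, add_zero]
    calc _ ≤ ∫⁻ _, ENNReal.ofReal (stepProb w k) ^ 2 ∂P := lintegral_mono fun ω => by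
          dsimp only
          gcongr
          exact leafLaw_coord_ne_self_le hw1 hw _ (fun n i => randomCoord_of_lt K Z ω) hk
      _ = _ := by simp
  | succ n hkn ih =>
    have hn : 1 ≤ n := hk.trans hkn
    set S : Set (ℕ → U) := {x | x k ≠ u₀} with hSdef
    have hS : MeasurableSet S := measurableSet_coord_ne u₀ k
    set s : Ω → ℝ≥0∞ := fun ω => randomLeafLaw lam hlam w B K Z n ω S with hs
    set t : Ω → ℝ≥0∞ := fun ω => S.indicator 1 (randomCoord lam hlam u₀ K Z ω n) with ht
    set a := ENNReal.ofReal (1 - stepProb w (n + 1)) with ha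
    set q := ENNReal.ofReal (stepProb w (n + 1)) with hq
    have haq : a + q = 1 := ofReal_one_sub_add_ofReal_stepProb hw (n + 1)
    have hsm : Measurable[pastSigma B K Z n] s := measurable_randomLeafLaw_apply hw1 hw n hS
    have hsm' : Measurable s := hsm.mono (h.pastSigma_le n) le_rfl
    have htt : ∀ ω, t ω ^ 2 = t ω := fun ω => by
      by_cases hx : randomCoord lam hlam u₀ K Z ω n ∈ S <;> simp [ht, hx]
    -- Given the past, t is the indicator of an event of conditional probability s: the subtree mass
    -- is a martingale.
    have hst : ∫⁻ ω, s ω * t ω ∂P = ∫⁻ ω, s ω ^ 2 ∂P := by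
      rw [h.lintegral_mul_randomCoord hw1 hw hn hsm (measurable_one.indicator hS)]
      refine lintegral_congr fun ω => ?_
      rw [lintegral_indicator_one hS, sq]
    have ht1 : ∫⁻ ω, t ω ∂P = ∫⁻ ω, s ω ∂P := by
      have := h.lintegral_mul_randomCoord (lam := lam) (hlam := hlam) hw1 hw hn
        (c := fun _ => 1) measurable_const (measurable_one.indicator hS)
      simp only [one_mul, lintegral_indicator_one hS] at this
      exact this
    have hrec : ∀ ω, randomLeafLaw lam hlam w B K Z (n + 1) ω S ^ 2 =
        a ^ 2 * s ω ^ 2 + (2 * a * q * (s ω * t ω) + q ^ 2 * t ω) := by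
      intro ω
      have : randomLeafLaw lam hlam w B K Z (n + 1) ω S = a * s ω + q * t ω :=
        leafLaw_coord_ne_succ hw1 hw _ _ hkn
      calc _ = (a * s ω + q * t ω) ^ 2 := by rw [this]
        _ = a ^ 2 * s ω ^ 2 + (2 * a * q * (s ω * t ω) + q ^ 2 * t ω ^ 2) := by ring
        _ = _ := by rw [htt]
    have htm : Measurable t := by
      have h1 : Measurable fun ω => randomCoord lam hlam u₀ K Z ω n :=
        (measurable_randomCoord_past B K Z n.lt_succ_self).mono (h.pastSigma_le _) le_rfl
      exact (measurable_one.indicator hS).comp h1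
    have hfirst : ∫⁻ ω, s ω ∂P ≤ ENNReal.ofReal (stepProb w k) :=
      h.lintegral_coord_ne_le hw1 hw hn k
    calc ∫⁻ ω, randomLeafLaw lam hlam w B K Z (n + 1) ω S ^ 2 ∂P
        = a ^ 2 * ∫⁻ ω, s ω ^ 2 ∂P + (2 * a * q * ∫⁻ ω, s ω ^ 2 ∂P + q ^ 2 * ∫⁻ ω, s ω ∂P) := by
          rw [lintegral_congr hrec, lintegral_add_left ((hsm'.pow_const 2).const_mul _),
            lintegral_add_left (f := fun ω => 2 * a * q * (s ω * t ω))
              ((hsm'.mul htm).const_mul _),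
            lintegral_const_mul _ (hsm'.pow_const 2),
            lintegral_const_mul (f := fun ω => s ω * t ω) _ (hsm'.mul htm),
            lintegral_const_mul _ htm, hst, ht1]
      _ = (a ^ 2 + 2 * a * q) * ∫⁻ ω, s ω ^ 2 ∂P + q ^ 2 * ∫⁻ ω, s ω ∂P := by ring
      -- Since a² + 2aq ≤ (a + q)² = 1, each step raises the second moment by at most q² times the
      -- first moment, which is at most q_k.
      _ ≤ 1 * ∫⁻ ω, s ω ^ 2 ∂P + q ^ 2 * ENNReal.ofReal (stepProb w k) := by
          gcongr
          calc a ^ 2 + 2 * a * q ≤ a ^ 2 + 2 * a * q + q ^ 2 := le_self_add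
            _ = (a + q) ^ 2 := by ring
            _ = 1 := by rw [haq, one_pow]
      _ ≤ _ := by
          rw [one_mul, Finset.sum_Ioc_succ_top (by omega), mul_add, ← add_assoc, mul_comm (q ^ 2)]
          gcongr

theorem IsRandomGluing.lintegral_coord_ne_sq_le (h : IsRandomGluing P w B K Z) (hw1 : 0 < w 1)
    (hw : ∀ n, 1 ≤ n → 0 ≤ w n) (hsum : Summable fun i => stepProb w i ^ 2) {k n : ℕ} (hk : 1 ≤ k) :
    ∫⁻ ω, randomLeafLaw lam hlam w B K Z n ω {x | x k ≠ u₀} ^ 2 ∂P ≤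
      ENNReal.ofReal (subtreeBound w k) := by
  rcases lt_or_ge n k with hnk | hkn
  · have : ∀ ω, randomLeafLaw lam hlam w B K Z n ω {x | x k ≠ u₀} = 0 := fun ω =>
      leafLaw_coord_ne_of_lt _ (fun n i => randomCoord_of_lt K Z ω) hnk
    simp [this]
  · refine (h.lintegral_coord_ne_sq_le_sum hw1 hw hk hkn).trans ?_
    have hq := stepProb_nonneg hw
    have htail : ∑ i ∈ Finset.Ioc k n, stepProb w i ^ 2 ≤ ∑' i, stepProb w (i + (k + 1)) ^ 2 := by
      have h1 := hsum.sum_le_tsum (Finset.range (n + 1)) fun i _ => sq_nonneg _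
      rw [← hsum.sum_add_tsum_nat_add (k + 1)] at h1
      have h2 : ∑ i ∈ Finset.range (n + 1), stepProb w i ^ 2 =
          ∑ i ∈ Finset.range (k + 1), stepProb w i ^ 2 + ∑ i ∈ Finset.Ioc k n, stepProb w i ^ 2 := by
        rw [Finset.range_eq_Ico, Finset.range_eq_Ico,
          ← Finset.sum_Ico_consecutive _ (Nat.zero_le (k + 1)) (show k + 1 ≤ n + 1 by omega)]
        congr 2
        ext i
        simp only [Finset.mem_Ico, Finset.mem_Ioc]
        omega
      linarith
    rw [subtreeBound, ENNReal.ofReal_add (sq_nonneg _)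
      (mul_nonneg (hq k) (tsum_nonneg fun i => sq_nonneg _)), ENNReal.ofReal_mul (hq k),
      ENNReal.ofReal_pow (hq k)]
    gcongr
    refine le_trans (le_of_eq ?_) (ENNReal.ofReal_le_ofReal htail)
    rw [ENNReal.ofReal_sum_of_nonneg fun i _ => sq_nonneg _]
    exact Finset.sum_congr rfl fun i _ => (ENNReal.ofReal_pow (hq i) 2).symm

/-- The probability that no block with index in `J` contributes a distance at least `r`. -/
theorem IsRandomGluing.lintegral_close_le (h : IsRandomGluing P w B K Z) (hw1 : 0 < w 1)
    (hw : ∀ n, 1 ≤ n → 0 ≤ w n) {r p : ℝ} (hr : 0 < r) (hp1 : p ≤ 1)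
    (hp : ∫⁻ ω, ((B 1 ω).ν : Measure U) {z | dist z u₀ < r} ∂P ≤ ENNReal.ofReal (1 - p))
    {n : ℕ} (hn : 1 ≤ n) (J : Finset ℕ) (hJ : ∀ k ∈ J, 1 ≤ k ∧ k ≤ n) :
    ∫⁻ ω, randomLeafLaw lam hlam w B K Z n ω {x | ∀ k ∈ J, dist (x k) u₀ < r} ∂P ≤
      ENNReal.ofReal (∏ k ∈ J, (1 - p * stepProb w k)) := by
  have hD : MeasurableSet {z : U | dist z u₀ < r} :=
    (isOpen_lt (by fun_prop) continuous_const).measurableSet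
  set φ : U → ℝ≥0∞ := {z : U | dist z u₀ < r}.indicator 1 with hφ
  have hφm : Measurable φ := measurable_one.indicator hD
  have hφ0 : φ u₀ = 1 := by simp [hφ, hr]
  have hprod : ∀ x : ℕ → U, ∏ k ∈ J, φ (x k) =
      {x : ℕ → U | ∀ k ∈ J, dist (x k) u₀ < r}.indicator 1 x := by
    intro x
    by_cases hx : ∀ k ∈ J, dist (x k) u₀ < r
    · rw [indicator_of_mem (by simpa using hx)]
      exact Finset.prod_eq_one fun k hk => by simp [hφ, hx k hk]
    · rw [indicator_of_notMem (by simpa using hx)]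
      push Not at hx
      obtain ⟨k, hk, hkr⟩ := hx
      exact Finset.prod_eq_zero hk (by simp [hφ, hkr])
  have hset : MeasurableSet {x : ℕ → U | ∀ k ∈ J, dist (x k) u₀ < r} := by
    have : {x : ℕ → U | ∀ k ∈ J, dist (x k) u₀ < r} =
        ⋂ k ∈ J, (fun x : ℕ → U => x k) ⁻¹' {z | dist z u₀ < r} := by ext; simp
    rw [this]
    exact Finset.measurableSet_biInter J fun k _ => (measurable_pi_apply k) hD
  set X : ℕ → Ω → ℝ≥0∞ := fun m ω => ENNReal.ofReal (1 - stepProb w (m + 1)) +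
    ENNReal.ofReal (stepProb w (m + 1)) * ∫⁻ z, φ z ∂((B (m + 1) ω).ν : Measure U) with hX
  have hXm : ∀ m, Measurable (X m) := fun m =>
    ((measurable_lintegral_block h.measurable_block (by omega) hφm).const_mul _).const_add _
  have hXi : iIndepFun X P := by
    refine h.indep_block.comp (fun m c => ENNReal.ofReal (1 - stepProb w (m + 1)) +
      ENNReal.ofReal (stepProb w (m + 1)) * ∫⁻ z, φ z ∂(c.ν : Measure U)) fun m => ?_
    exact (((Measure.measurable_lintegral hφm).comp measurable_block_ν).const_mul _).const_add _
  -- The independent family of blocks is indexed from 0, so J is shifted by one; `Nat.pred` is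
  -- injective on J because 0 ∉ J.
  have hinj : Set.InjOn Nat.pred J := fun a ha b hb hab => by
    have h1 := (hJ a ha).1
    have h2 := (hJ b hb).1
    simp only [Nat.pred_eq_sub_one] at hab
    omega
  have hmain := h.lintegral_prod_coord (lam := lam) (hlam := hlam) hw1 hw (f := fun _ => φ)
    (fun _ => hφm) hn J (c := fun _ => 1) measurable_const
  simp only [one_mul, hprod, lintegral_indicator_one hset] at hmain
  rw [hmain]
  have hXJ : ∀ ω, ∏ i ∈ J, coordMean w (fun k => B k ω) n i φ = ∏ m ∈ J.image Nat.pred, X m ω := by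
    intro ω
    rw [Finset.prod_image hinj]
    refine Finset.prod_congr rfl fun i hi => ?_
    obtain ⟨m, rfl⟩ : ∃ m, i = m + 1 := ⟨i - 1, by have := (hJ i hi).1; omega⟩
    rw [coordMean, if_pos (hJ _ hi), hφ0, mul_one]
    rfl
  simp_rw [hXJ]
  rw [lintegral_prod_eq_prod_lintegral_of_indepFun _ X hXi hXm, Finset.prod_image hinj,
    ENNReal.ofReal_prod_of_nonneg fun k _ => by
      nlinarith [stepProb_nonneg hw k, stepProb_le_one hw k]]
  refine Finset.prod_le_prod' fun i hi => ?_
  obtain ⟨m, rfl⟩ : ∃ m, i = m + 1 := ⟨i - 1, by have := (hJ i hi).1; omega⟩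
  have hq := stepProb_nonneg hw (m + 1)
  have hq1 := stepProb_le_one hw (m + 1)
  simp only [Nat.pred_succ, hX]
  rw [lintegral_add_left measurable_const, lintegral_const_mul' _ _ ENNReal.ofReal_ne_top,
    lintegral_block_eq h (by omega) hφm]
  simp only [hφ, lintegral_indicator_one hD, lintegral_const, measure_univ, mul_one]
  calc _ ≤ ENNReal.ofReal (1 - stepProb w (m + 1)) +
        ENNReal.ofReal (stepProb w (m + 1)) * ENNReal.ofReal (1 - p) := by gcongr
    _ = _ := by
        rw [← ENNReal.ofReal_mul hq, ← ENNReal.ofReal_add (by linarith)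
          (mul_nonneg hq (by linarith))]
        congr 1
        ring

end MassMoments

/-! ### The glued blocks are compact, and carry the random points -/

section Support

theorem continuous_truncateSeq {U : Type*} [MetricSpace U] (u₀ : U) (n : ℕ) : Continuous (truncateSeq u₀ n) := by
  refine continuous_pi fun i => ?_
  unfold truncateSeq
  split_ifs
  exacts [continuous_apply i, continuous_const]

variable {U : Type*} [MetricSpace U] [MeasurableSpace U] {u₀ : U}
  {lam w : ℕ → ℝ} {hlam : ∀ n, 1 ≤ n → 0 < lam n} {b : ℕ → Block u₀} {K : ℕ → ℕ} {Z : ℕ → U}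

/-- A finite union of continuous images of compact blocks, for the product topology. The resulting
closedness lets membership of truncations in 𝒯ₘ survive weak limits. -/
theorem isCompact_coord_image_glued (b : ℕ → Block u₀) (K : ℕ → ℕ) (Z : ℕ → U) (n : ℕ) :
    IsCompact (EllOne.coord '' glued lam hlam b K Z n) := by
  have : EllOne.coord '' glued lam hlam b K Z n = ⋃ k ∈ Finset.Icc 1 n,
      (fun z => Function.update (glueCoord lam hlam u₀ K Z (k - 1)) k z) ''
        ((b k).carrier : Set U) := by
    ext x
    simp only [glued, gluedBlock, mem_image, mem_iUnion, Finset.mem_Icc]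
    constructor
    · rintro ⟨_, ⟨k, hk, hkn, z, hz, rfl⟩, rfl⟩
      exact ⟨k, ⟨hk, hkn⟩, z, hz, rfl⟩
    · rintro ⟨k, ⟨hk, hkn⟩, z, hz, rfl⟩
      exact ⟨_, ⟨k, hk, hkn, z, hz, rfl⟩, rfl⟩
  rw [this]
  exact Finset.isCompact_biUnion _ fun k _ => (b k).carrier.isCompact.image
    (continuous_const.update k continuous_id)

/-- The gluing points lie on the blocks they are supposed to lie on. -/
def IsGrafting (b : ℕ → Block u₀) (K : ℕ → ℕ) (Z : ℕ → U) : Prop :=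
  ∀ n, 1 ≤ n → 1 ≤ K n ∧ K n ≤ n ∧ Z n ∈ (b (K n)).carrier

theorem glueCoord_eq_update (h : IsGrafting b K Z) {n : ℕ} (hn : 1 ≤ n) :
    glueCoord lam hlam u₀ K Z n =
      Function.update (glueCoord lam hlam u₀ K Z (K n - 1)) (K n) (Z n) := by
  rw [glueCoord_eq, graftPoint, if_pos ⟨(h n hn).1, (h n hn).2.1⟩]

/-- If k ≤ m, truncation changes nothing. If k > m, it erases the k-th coordinate and leaves the
truncation of the root of block k, a point of an earlier block. -/
theorem truncateSeq_update_mem (h : IsGrafting b K Z) {m : ℕ} (hm : 1 ≤ m) {k : ℕ} (hk : 1 ≤ k)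
    {z : U} (hz : z ∈ (b k).carrier) :
    truncateSeq u₀ m (Function.update (glueCoord lam hlam u₀ K Z (k - 1)) k z) ∈
      EllOne.coord '' glued lam hlam b K Z m := by
  induction k using Nat.strong_induction_on generalizing z with
  | _ k ih =>
    rcases le_or_gt k m with hkm | hkm
    · refine ⟨(gluePoint u₀ lam hlam K Z (k - 1)).update k hk z, ?_, ?_⟩
      · simp only [glued, mem_iUnion]
        exact ⟨k, hk, hkm, z, hz, rfl⟩
      · funext i
        rw [truncateSeq, EllOne.coord_update]
        split_ifs with hi
        · rfl
        · rw [Function.update_of_ne (by omega)]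
          exact gluePoint_coord_of_lt K Z _ (by omega)
    · obtain ⟨h1, h2, h3⟩ := h (k - 1) (by omega)
      have := ih (K (k - 1)) (by omega) h1 h3
      rw [← glueCoord_eq_update h (by omega)] at this
      convert this using 1
      funext i
      unfold truncateSeq
      split_ifs with hi
      · rw [Function.update_of_ne (by omega)]
      · rfl

/-- The product of the blocks. -/
def blockProduct (b : ℕ → Block u₀) : Set (ℕ → U) :=
  Set.univ.pi fun i => if i = 0 then {u₀} else ((b i).carrier : Set U)

/-- By Tychonoff. Under `IsGrafting`, this one compact set carries all the laws `leafLaw`, so their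
tightness is automatic. -/
theorem isCompact_blockProduct (b : ℕ → Block u₀) : IsCompact (blockProduct b) := by
  refine isCompact_univ_pi fun i => ?_
  split_ifs
  exacts [isCompact_singleton, (b i).carrier.isCompact]

theorem update_mem_blockProduct (h : IsGrafting b K Z) {k : ℕ} (hk : 1 ≤ k)
    {z : U} (hz : z ∈ (b k).carrier) :
    Function.update (glueCoord lam hlam u₀ K Z (k - 1)) k z ∈ blockProduct b := by
  induction k using Nat.strong_induction_on generalizing z with
  | _ k ih =>
    have hp : glueCoord lam hlam u₀ K Z (k - 1) ∈ blockProduct b := by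
      rcases Nat.eq_zero_or_pos (k - 1) with h0 | h0
      · intro i _
        rw [h0, glueCoord_zero]
        dsimp only
        split_ifs
        exacts [rfl, (b i).root_mem]
      · obtain ⟨h1, h2, h3⟩ := h (k - 1) h0
        rw [glueCoord_eq_update h h0]
        exact ih (K (k - 1)) (by omega) h1 h3
    intro i hi
    by_cases hik : i = k
    · subst hik
      rw [Function.update_self]
      dsimp only
      rw [if_neg (by omega)]
      exact hz
    · rw [Function.update_of_ne hik]
      exact hp i hi

end Support

/-! ### Grafting points almost surely lie in their blocks. -/

section RandomSupport

theorem measurable_indicator_prod {X Y : Type*} [MeasurableSpace X] [MeasurableSpace Y]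
    {s : Set X} {t : Set Y} (hs : MeasurableSet s) (ht : MeasurableSet t) :
    Measurable ((s ×ˢ t).indicator (1 : X × Y → ℝ≥0∞)) :=
  measurable_one.indicator (hs.prod ht)

/-- Meeting an open set is an open condition for the Hausdorff distance. -/
theorem measurableSet_carrier_inter_eq_empty {U : Type*} [MetricSpace U] [MeasurableSpace U]
    {u₀ : U} {V : Set U} (hV : IsOpen V) :
    MeasurableSet {c : Block u₀ | ¬ ((c.carrier : Set U) ∩ V).Nonempty} := by
  have h1 : MeasurableSet[borel (TopologicalSpace.NonemptyCompacts U)]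
      {C : TopologicalSpace.NonemptyCompacts U | ((C : Set U) ∩ V).Nonempty} :=
    MeasurableSpace.measurableSet_generateFrom
      (TopologicalSpace.NonemptyCompacts.isOpen_inter_nonempty_of_isOpen hV)
  have h2 : MeasurableSet {c : Block u₀ | ((c.carrier : Set U) ∩ V).Nonempty} :=
    (le_sup_left : MeasurableSpace.comap Block.carrier _ ≤ _) _ ⟨_, h1, rfl⟩
  exact h2.compl

variable {U : Type*} [MetricSpace U] [SecondCountableTopology U] [MeasurableSpace U]
  [BorelSpace U] {u₀ : U} {w : ℕ → ℝ}
  {Ω : Type*} [mΩ : MeasurableSpace Ω] {P : Measure Ω} [IsProbabilityMeasure P]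
  {B : ℕ → Ω → Block u₀} {K : ℕ → Ω → ℕ} {Z : ℕ → Ω → U}

/-- As the blocks are closed, Z n falls outside its block only if, for some k and some basic open V,
block k misses V while K n = k and Z n ∈ V. The condition on the block is measurable with respect to
the past, so each of these countably many events is null by the conditional law. -/
theorem IsRandomGluing.ae_isGrafting (h : IsRandomGluing P w B K Z) (hw1 : 0 < w 1)
    (hw : ∀ n, 1 ≤ n → 0 ≤ w n) :
    ∀ᵐ ω ∂P, IsGrafting (fun k => B k ω) (fun n => K n ω) (fun n => Z n ω) := by
  rw [show (∀ᵐ ω ∂P, IsGrafting (fun k => B k ω) (fun n => K n ω) (fun n => Z n ω)) ↔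
    ∀ᵐ ω ∂P, ∀ n, 1 ≤ n → 1 ≤ K n ω ∧ K n ω ≤ n ∧ Z n ω ∈ (B (K n ω) ω).carrier from Iff.rfl,
    ae_all_iff]
  intro n
  rw [eventually_imp_distrib_left]
  intro hn
  -- an event of null conditional probability given the past is null
  have null : ∀ (E : Set Ω) (A : Set (ℕ × U)), MeasurableSet[pastSigma B K Z n] E →
      MeasurableSet A → (∀ ω ∈ E, graftLaw w (fun k => B k ω) n A = 0) →
      ∀ᵐ ω ∂P, ¬ (ω ∈ E ∧ (K n ω, Z n ω) ∈ A) := by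
    intro E A hE hA h0
    have hF : Measurable[(pastSigma B K Z n).prod inferInstance]
        ((E ×ˢ A).indicator (1 : Ω × ℕ × U → ℝ≥0∞)) :=
      @measurable_indicator_prod Ω (ℕ × U) (pastSigma B K Z n) _ E A hE hA
    have h1 := h.lintegral_graft hw1 hw hn hF
    have h2 : ∀ ω, ∫⁻ q, (E ×ˢ A).indicator (1 : Ω × ℕ × U → ℝ≥0∞) (ω, q)
        ∂graftLaw w (fun k => B k ω) n = 0 := by
      intro ω
      by_cases hω : ω ∈ E
      · have : ∀ q, (E ×ˢ A).indicator (1 : Ω × ℕ × U → ℝ≥0∞) (ω, q) = A.indicator 1 q := by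
          intro q
          by_cases hq : q ∈ A <;> simp [hω, hq]
        simp_rw [this]
        rw [lintegral_indicator_one hA, h0 ω hω]
      · simp [hω]
    have hF' : Measurable fun ω => (E ×ˢ A).indicator (1 : Ω × ℕ × U → ℝ≥0∞) (ω, K n ω, Z n ω) :=
      (measurable_one.indicator ((h.pastSigma_le n E hE).prod hA)).comp
        (measurable_id.prodMk (h.measurable_graft n hn))
    simp only [h2, lintegral_zero] at h1
    rw [lintegral_eq_zero_iff hF'] at h1
    filter_upwards [h1] with ω hω hmem
    simp [hmem.1, hmem.2] at hω
  have hK : ∀ᵐ ω ∂P, 1 ≤ K n ω ∧ K n ω ≤ n := by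
    have := null univ ({k : ℕ | ¬ (1 ≤ k ∧ k ≤ n)} ×ˢ univ) MeasurableSet.univ
      ((MeasurableSet.of_discrete).prod MeasurableSet.univ) fun ω _ => by
        rw [← lintegral_indicator_one ((MeasurableSet.of_discrete).prod MeasurableSet.univ),
          lintegral_graftLaw _ n (measurable_one.indicator
            ((MeasurableSet.of_discrete).prod MeasurableSet.univ))]
        refine Finset.sum_eq_zero fun k hk => ?_
        have hk' := Finset.mem_Icc.1 hk
        simp [hk'.1, hk'.2]
    filter_upwards [this] with ω hω
    simpa using hω
  have hZ : ∀ᵐ ω ∂P, ∀ V ∈ TopologicalSpace.countableBasis U, ∀ k, 1 ≤ k →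
      ¬ (ω ∈ (B k) ⁻¹' {c : Block u₀ | ¬ ((c.carrier : Set U) ∩ V).Nonempty} ∧
        (K n ω, Z n ω) ∈ ({k} : Set ℕ) ×ˢ V) := by
    rw [ae_ball_iff (TopologicalSpace.countable_countableBasis U)]
    intro V hV
    rw [ae_all_iff]
    intro k
    rw [eventually_imp_distrib_left]
    intro hk
    have hVo := TopologicalSpace.isOpen_of_mem_countableBasis hV
    refine null _ _ ((measurable_block_past K Z n hk) (measurableSet_carrier_inter_eq_empty hVo))
      ((measurableSet_singleton k).prod hVo.measurableSet) fun ω hω => ?_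
    have hm : MeasurableSet (({k} : Set ℕ) ×ˢ V) :=
      (measurableSet_singleton k).prod hVo.measurableSet
    rw [← lintegral_indicator_one hm, lintegral_graftLaw _ n (measurable_one.indicator hm)]
    refine Finset.sum_eq_zero fun j hj => ?_
    rw [mul_eq_zero]
    right
    by_cases hjk : j = k
    · subst hjk
      have h1 : ∀ᵐ z ∂((B j ω).ν : Measure U), z ∈ (B j ω).carrier := (B j ω).ν_compl
      rw [← lintegral_zero (μ := ((B j ω).ν : Measure U))]
      refine lintegral_congr_ae ?_
      filter_upwards [h1] with z hz
      have hzV : z ∉ V := fun hzV => hω ⟨z, hz, hzV⟩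
      simp [hzV]
    · simp [hjk]
  filter_upwards [hK, hZ] with ω h1 h2
  refine ⟨h1.1, h1.2, ?_⟩
  by_contra hmem
  have hopen : IsOpen ((B (K n ω) ω).carrier : Set U)ᶜ :=
    (B (K n ω) ω).carrier.isCompact.isClosed.isOpen_compl
  obtain ⟨V, hV, hZV, hVsub⟩ := (TopologicalSpace.isBasis_countableBasis U).exists_subset_of_mem_open
    (show Z n ω ∈ ((B (K n ω) ω).carrier : Set U)ᶜ from hmem) hopen
  refine h2 V hV (K n ω) h1.1 ⟨?_, rfl, hZV⟩
  rintro ⟨z, hz, hzV⟩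
  exact hVsub hzV hz

end RandomSupport

/-! ### The law of the height. -/

section Height

variable {U : Type*} [MetricSpace U] [MeasurableSpace U] [BorelSpace U] {u₀ : U}
  {Ω : Type*} [MeasurableSpace Ω] {P : Measure Ω} {B₁ : Ω → Block u₀}

theorem lintegral_heightLaw (hB : Measurable B₁) {g : ℝ → ℝ≥0∞} (hg : Measurable g) :
    ∫⁻ t, g t ∂heightLaw P B₁ = ∫⁻ ω, ∫⁻ z, g (dist z u₀) ∂((B₁ ω).ν : Measure U) ∂P := by
  have hd : Measurable fun x : U => dist u₀ x := (continuous_const.dist continuous_id).measurable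
  rw [heightLaw, lintegral_map hg hd, Measure.lintegral_bind (f := fun x => g (dist u₀ x))
    (μ := fun ω => ((B₁ ω).ν : Measure U)) (measurable_block_ν.comp hB).aemeasurable
    (hg.comp hd).aemeasurable]
  simp_rw [dist_comm u₀]

theorem lintegral_dist_lt_top [IsProbabilityMeasure P] (hB : Measurable B₁)
    (hH2 : ∫⁻ h, ENNReal.ofReal (h ^ 2) ∂(heightLaw P B₁) < ∞) :
    ∫⁻ ω, ∫⁻ z, ENNReal.ofReal (dist z u₀) ∂((B₁ ω).ν : Measure U) ∂P < ∞ := by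
  have hm : Measurable fun h : ℝ => ENNReal.ofReal (h ^ 2) := by fun_prop
  rw [← lintegral_heightLaw hB ENNReal.measurable_ofReal]
  refine lt_of_le_of_lt (lintegral_mono (g := fun h => 1 + ENNReal.ofReal (h ^ 2)) fun h => ?_) ?_
  · dsimp only
    rw [← ENNReal.ofReal_one, ← ENNReal.ofReal_add zero_le_one (sq_nonneg h)]
    exact ENNReal.ofReal_le_ofReal (by nlinarith [sq_nonneg (h - 1)])
  · rw [lintegral_add_left measurable_const, lintegral_heightLaw hB measurable_const]
    simpa using hH2

/-- The half-line (0, ∞) is the union of the half-lines [1/(n+1), ∞), so one of these has positive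
mass p; r is its endpoint. -/
theorem exists_lintegral_dist_lt_le [IsProbabilityMeasure P] (hB : Measurable B₁)
    (hH0 : 0 < heightLaw P B₁ (Ioi 0)) : ∃ r p : ℝ, 0 < r ∧ 0 < p ∧ p ≤ 1 ∧
      ∫⁻ ω, ((B₁ ω).ν : Measure U) {z | dist z u₀ < r} ∂P ≤ ENNReal.ofReal (1 - p) := by
  have hU : (Ioi 0 : Set ℝ) = ⋃ n : ℕ, Ici (1 / ((n : ℝ) + 1)) := by
    ext t
    simp only [mem_Ioi, mem_iUnion, mem_Ici]
    refine ⟨fun ht => ?_, fun ⟨n, hn⟩ => (by positivity : (0 : ℝ) < 1 / ((n : ℝ) + 1)).trans_le hn⟩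
    obtain ⟨n, hn⟩ := exists_nat_one_div_lt ht
    exact ⟨n, hn.le⟩
  rw [hU] at hH0
  obtain ⟨n, hn⟩ := exists_measure_pos_of_not_measure_iUnion_null hH0.ne'
  set r : ℝ := 1 / ((n : ℝ) + 1) with hr
  have hprob : IsProbabilityMeasure (heightLaw P B₁) := by
    refine ⟨?_⟩
    rw [← lintegral_one, lintegral_heightLaw (g := fun _ => 1) hB measurable_const]
    simp
  refine ⟨r, (heightLaw P B₁).real (Ici r), by positivity,
    ENNReal.toReal_pos hn.ne' (measure_ne_top _ _), measureReal_le_one, ?_⟩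
  have h1 : ∫⁻ ω, ((B₁ ω).ν : Measure U) {z | dist z u₀ < r} ∂P = heightLaw P B₁ (Iio r) := by
    rw [← lintegral_indicator_one measurableSet_Iio,
      lintegral_heightLaw hB (measurable_one.indicator measurableSet_Iio)]
    refine lintegral_congr fun ω => ?_
    have hD : MeasurableSet {z : U | dist z u₀ < r} :=
      (isOpen_lt (by fun_prop) continuous_const).measurableSet
    rw [← lintegral_indicator_one hD]
    rfl
  rw [h1, ← probReal_compl_eq_one_sub measurableSet_Ici, compl_Ici, measureReal_def,
    ENNReal.ofReal_toReal (measure_ne_top _ _)]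

end Height

/-! ### The lower bound on the dimension -/

section Main

theorem isOpen_close {U : Type*} [MetricSpace U] (J : Finset ℕ) (u₀ : U) (r : ℝ) :
    IsOpen {x : ℕ → U | ∀ k ∈ J, dist (x k) u₀ < r} := by
  have : {x : ℕ → U | ∀ k ∈ J, dist (x k) u₀ < r} =
      ⋂ k ∈ J, {x : ℕ → U | dist (x k) u₀ < r} := by ext; simp
  rw [this]
  exact isOpen_biInter_finset fun k _ =>
    isOpen_lt ((continuous_apply k).dist continuous_const) continuous_const

theorem isOpen_coord_ne {U : Type*} [MetricSpace U] (u₀ : U) (k : ℕ) : IsOpen {x : ℕ → U | x k ≠ u₀} :=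
  isOpen_ne.preimage (continuous_apply k)

variable {U : Type*} [MetricSpace U] [SecondCountableTopology U] [MeasurableSpace U]
  [BorelSpace U] {u₀ : U} {lam w : ℕ → ℝ} {hlam : ∀ n, 1 ≤ n → 0 < lam n} {α ε r : ℝ}

open Classical in
/-- The quantity that controls the limits of the laws `leafLaw`. -/
noncomputable def leafEnergy (lam : ℕ → ℝ) (u₀ : U) (α ε r : ℝ) (n : ℕ) (ν : Measure (ℕ → U)) :
    ℝ≥0∞ :=
  (∑' j, if ∀ k ∈ scaleIndices lam α ε j, k ≤ n then
    ν {x | ∀ k ∈ scaleIndices lam α ε j, dist (x k) u₀ < r} else 0) +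
  (∑' k : ℕ, ENNReal.ofReal ((k : ℝ) ^ (1 - ε)) * ν {x | x k ≠ u₀} ^ 2) +
  ∑' k, ∫⁻ x, ENNReal.ofReal (|lam k| * dist (x k) u₀) ∂ν

/-- The lower bound, for a given realisation of the construction. -/
theorem dimBound_le_dimH_leaves_of_leafEnergy [CompleteSpace U] (hw1 : 0 < w 1)
    (hw : ∀ n, 1 ≤ n → 0 ≤ w n) {b : ℕ → Block u₀} {K : ℕ → ℕ} {Z : ℕ → U}
    (hb : IsGrafting b K Z) (hα : 0 < α) (hε : 0 < ε) (hε2 : ε < 1 / 2) (hr : 0 < r)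
    {M : ℝ≥0∞} (hM : M ≠ ∞)
    (hfreq : ∃ᶠ n in atTop, leafEnergy lam u₀ α ε r (n + 1)
      (leafLaw w b (glueCoord lam hlam u₀ K Z) (n + 1)) < M) :
    ENNReal.ofReal (dimBound α ε) ≤ dimH (leaves lam hlam b K Z) := by
  classical
  -- The shift avoids `leafLaw` at 0, which is the zero measure.
  set ν : ℕ → Measure (ℕ → U) := fun n => leafLaw w b (glueCoord lam hlam u₀ K Z) (n + 1) with hν
  have hprob : ∀ n, IsProbabilityMeasure (ν n) := fun n =>
    isProbabilityMeasure_leafLaw hw1 hw b _ (by omega)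
  have hC := isCompact_blockProduct b
  have hνC : ∀ n, ν n (blockProduct b)ᶜ = 0 := fun n =>
    leafLaw_compl_eq_zero b _ _ hC.isClosed.measurableSet fun k hk _ z hz =>
      update_mem_blockProduct hb hk hz
  -- The weak limit is taken along indices at which the energy is below M, so each of its three
  -- terms is bounded by M along the subsequence.
  obtain ⟨θ, hθ, hθM, μ, hμ, hlim⟩ := exists_limit_measure ν hC hνC hfreq
  have hle1 : ∀ n, (∑' j, if ∀ k ∈ scaleIndices lam α ε j, k ≤ θ n + 1 then
      ν (θ n) {x | ∀ k ∈ scaleIndices lam α ε j, dist (x k) u₀ < r} else 0) ≤ M := fun n => by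
    refine le_trans (le_trans ?_ le_self_add) ((le_self_add).trans (hθM n).le)
    rfl
  have hle2 : ∀ n, ∑' k : ℕ, ENNReal.ofReal ((k : ℝ) ^ (1 - ε)) * ν (θ n) {x | x k ≠ u₀} ^ 2 ≤ M :=
    fun n => le_trans le_add_self ((le_self_add).trans (hθM n).le)
  have hle3 : ∀ n, ∑' k, ∫⁻ x, ENNReal.ofReal (|lam k| * dist (x k) u₀) ∂ν (θ n) ≤ M :=
    fun n => le_trans le_add_self (hθM n).le
  have hCμ : μ (blockProduct b)ᶜ = 0 :=
    measure_eq_zero_of_le_liminf (hlim _ hC.isClosed.isOpen_compl)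
      (Eventually.of_forall fun n => hνC _)
  refine dimBound_le_dimH_leaves μ hα hε hε2 hr ?_ ?_ (ne_top_of_le_ne_top hM ?_)
    (ne_top_of_le_ne_top hM ?_) (ne_top_of_le_ne_top hM ?_)
  · have : ∀ᵐ x ∂μ, x ∈ blockProduct b := hCμ
    filter_upwards [this] with x hx
    simpa using hx 0 (mem_univ 0)
  · rw [ae_all_iff]
    intro m
    rw [eventually_imp_distrib_left]
    intro hm
    -- The complement is open and null for every law of the sequence, hence null for μ.
    have hcl : IsClosed (truncateSeq u₀ m ⁻¹' (EllOne.coord '' glued lam hlam b K Z m)) :=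
      (isCompact_coord_image_glued b K Z m).isClosed.preimage (continuous_truncateSeq u₀ m)
    exact measure_eq_zero_of_le_liminf (hlim _ hcl.isOpen_compl) (Eventually.of_forall fun n =>
      leafLaw_compl_eq_zero b _ _ hcl.measurableSet fun k hk _ z hz =>
        truncateSeq_update_mem hb hm hk hz)
  · refine tsum_measure_le_of_le_liminf (fun j => hlim _ (isOpen_close _ u₀ r))
      (N := fun j n => ∀ k ∈ scaleIndices lam α ε j, k ≤ θ n + 1) (fun j => ?_) hle1
    refine (Finset.eventually_all _).2 fun k _ => ?_
    filter_upwards [eventually_ge_atTop k] with n hn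
    exact (hn.trans (hθ.id_le n)).trans (Nat.le_succ _)
  · exact tsum_measure_sq_le_of_le_liminf (fun k => ENNReal.ofReal_ne_top)
      (fun k => hlim _ (isOpen_coord_ne u₀ k)) hle2
  · exact tsum_lintegral_le_of_le_liminf (f := fun k x => |lam k| * dist (x k) u₀)
      (fun k => continuous_const.mul
        ((continuous_apply (A := fun _ : ℕ => U) k).dist continuous_const))
      (fun k x => by positivity) hlim hle3

variable {Ω : Type*} [mΩ : MeasurableSpace Ω] {P : Measure Ω}
  {B : ℕ → Ω → Block u₀} {K : ℕ → Ω → ℕ} {Z : ℕ → Ω → U}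

theorem measurable_leafEnergy (h : IsRandomGluing P w B K Z) (hw1 : 0 < w 1)
    (hw : ∀ n, 1 ≤ n → 0 ≤ w n) (n : ℕ) : Measurable fun ω =>
      leafEnergy lam u₀ α ε r n (randomLeafLaw lam hlam w B K Z n ω) := by
  have hm : ∀ s : Set (ℕ → U), MeasurableSet s →
      Measurable fun ω => randomLeafLaw lam hlam w B K Z n ω s := fun s hs =>
    (measurable_randomLeafLaw_apply hw1 hw n hs).mono (h.pastSigma_le n) le_rfl
  unfold leafEnergy
  refine ((Measurable.tsum fun j => ?_).add (Measurable.tsum fun k => ?_)).add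
    (Measurable.tsum fun k => ?_)
  · split_ifs
    exacts [hm _ (isOpen_close _ u₀ r).measurableSet, measurable_const]
  · exact ((hm _ (isOpen_coord_ne u₀ k).measurableSet).pow_const 2).const_mul _
  · exact (measurable_lintegral_randomLeafLaw hw1 hw n
      (((measurable_pi_apply k).dist measurable_const).const_mul _).ennreal_ofReal).mono
      (h.pastSigma_le n) le_rfl

variable [IsProbabilityMeasure P]

/-- The three terms are bounded by the product formula for the crossings, the second moment of the
subtree masses and the first moment of the height. The restriction to scales with all indices at
most n is what makes the product formula applicable. -/
theorem IsRandomGluing.exists_lintegral_leafEnergy_le (h : IsRandomGluing P w B K Z)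
    (hlam : ∀ n, 1 ≤ n → 0 < lam n) (hw1 : 0 < w 1)
    (hw : ∀ n, 1 ≤ n → 0 ≤ w n) (hg : GrowthBounds lam w α) (hε : 0 < ε) (hε1 : ε < 1)
    (hH : ∫⁻ ω, ∫⁻ z, ENNReal.ofReal (dist z u₀) ∂((B 1 ω).ν : Measure U) ∂P < ∞)
    {p : ℝ} (hr : 0 < r) (hp0 : 0 < p) (hp1 : p ≤ 1)
    (hp : ∫⁻ ω, ((B 1 ω).ν : Measure U) {z | dist z u₀ < r} ∂P ≤ ENNReal.ofReal (1 - p)) :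
    ∃ C : ℝ≥0∞, C ≠ ∞ ∧ ∀ n, 1 ≤ n →
      ∫⁻ ω, leafEnergy lam u₀ α ε r n (randomLeafLaw lam hlam w B K Z n ω) ∂P ≤ C := by
  set H := ∫⁻ ω, ∫⁻ z, ENNReal.ofReal (dist z u₀) ∂((B 1 ω).ν : Measure U) ∂P with hHdef
  refine ⟨(∑' j, ENNReal.ofReal (∏ k ∈ scaleIndices lam α ε j, (1 - p * stepProb w k))) +
    (∑' k : ℕ, ENNReal.ofReal ((k : ℝ) ^ (1 - ε) * subtreeBound w k)) +
    (∑' k, ENNReal.ofReal (lam k * stepProb w k)) * H, ?_, fun n hn => ?_⟩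
  · exact ENNReal.add_ne_top.2 ⟨ENNReal.add_ne_top.2
      ⟨(hg.summable_prod hw hε hp0 hp1).tsum_ofReal_ne_top, (hg.summable_subtreeBound hw hε hε1).tsum_ofReal_ne_top⟩,
      ENNReal.mul_ne_top (hg.summable_lam_mul hlam hw).tsum_ofReal_ne_top hH.ne⟩
  have hm : ∀ s : Set (ℕ → U), MeasurableSet s →
      Measurable fun ω => randomLeafLaw lam hlam w B K Z n ω s := fun s hs =>
    (measurable_randomLeafLaw_apply hw1 hw n hs).mono (h.pastSigma_le n) le_rfl
  have hm1 : ∀ j, Measurable fun ω => if ∀ k ∈ scaleIndices lam α ε j, k ≤ n then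
      randomLeafLaw lam hlam w B K Z n ω
        {x | ∀ k ∈ scaleIndices lam α ε j, dist (x k) u₀ < r} else 0 := fun j => by
    split_ifs
    exacts [hm _ (isOpen_close _ u₀ r).measurableSet, measurable_const]
  have hm2 : ∀ k : ℕ, Measurable fun ω => ENNReal.ofReal ((k : ℝ) ^ (1 - ε)) *
      randomLeafLaw lam hlam w B K Z n ω {x | x k ≠ u₀} ^ 2 := fun k =>
    ((hm _ (isOpen_coord_ne u₀ k).measurableSet).pow_const 2).const_mul _
  have hf : ∀ k : ℕ, Measurable fun z : U => ENNReal.ofReal (|lam k| * dist z u₀) := fun k =>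
    ((measurable_id.dist measurable_const).const_mul _).ennreal_ofReal
  have hm3 : ∀ k : ℕ, Measurable fun ω => ∫⁻ x, ENNReal.ofReal (|lam k| * dist (x k) u₀)
      ∂randomLeafLaw lam hlam w B K Z n ω := fun k =>
    (measurable_lintegral_randomLeafLaw hw1 hw n ((hf k).comp (measurable_pi_apply k))).mono
      (h.pastSigma_le n) le_rfl
  unfold leafEnergy
  rw [lintegral_add_right _ (Measurable.tsum hm3), lintegral_add_right _ (Measurable.tsum hm2),
    lintegral_tsum fun j => (hm1 j).aemeasurable, lintegral_tsum fun j => (hm2 j).aemeasurable,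
    lintegral_tsum fun j => (hm3 j).aemeasurable]
  refine add_le_add (add_le_add (ENNReal.tsum_le_tsum fun j => ?_)
    (ENNReal.tsum_le_tsum fun k => ?_)) ?_
  · split_ifs with hj
    · exact h.lintegral_close_le hw1 hw hr hp1 hp hn _ fun k hk =>
        ⟨one_le_of_mem_scaleIndices hk, hj k hk⟩
    · simp
  · rcases Nat.eq_zero_or_pos k with rfl | hk
    · simp [Real.zero_rpow (by linarith : (1 : ℝ) - ε ≠ 0)]
    rw [lintegral_const_mul' _ _ ENNReal.ofReal_ne_top, ENNReal.ofReal_mul (by positivity)]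
    gcongr
    exact h.lintegral_coord_ne_sq_le hw1 hw (hg.summable_stepProb_sq hw) hk
  · rw [← ENNReal.tsum_mul_right]
    refine ENNReal.tsum_le_tsum fun k => ?_
    refine (h.lintegral_coord_le hw1 hw (hf k) (by simp) hn k).trans (le_of_eq ?_)
    rcases Nat.eq_zero_or_pos k with rfl | hk
    · simp [stepProb_zero]
    simp_rw [ENNReal.ofReal_mul (abs_nonneg (lam k)), abs_of_pos (hlam k hk)]
    simp_rw [lintegral_const_mul' _ _ ENNReal.ofReal_ne_top]
    rw [ENNReal.ofReal_mul (hlam k hk).le, hHdef]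
    ring

/-- By Fatou the liminf of the energies has finite expectation, so for almost every ω infinitely
many n have energy below a finite M. Both M and the limit measure depend on ω; the deterministic
lemma is applied to each realisation, so no measurable choice is needed. -/
theorem IsRandomGluing.ae_dimBound_le_dimH_leaves [CompleteSpace U] (h : IsRandomGluing P w B K Z)
    (hlam : ∀ n, 1 ≤ n → 0 < lam n) (hw1 : 0 < w 1) (hw : ∀ n, 1 ≤ n → 0 ≤ w n)
    (hg : GrowthBounds lam w α)
    (hH2 : ∫⁻ h, ENNReal.ofReal (h ^ 2) ∂(heightLaw P (B 1)) < ∞)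
    (hH0 : 0 < heightLaw P (B 1) (Ioi 0)) (hε : 0 < ε) (hε2 : ε < 1 / 2) :
    ∀ᵐ ω ∂P, ENNReal.ofReal (dimBound α ε) ≤
      dimH (leaves lam hlam (fun k => B k ω) (fun n => K n ω) (fun n => Z n ω)) := by
  have hB := h.measurable_block 1 le_rfl
  obtain ⟨r, p, hr, hp0, hp1, hp⟩ := exists_lintegral_dist_lt_le hB hH0
  obtain ⟨C, hC, hCn⟩ := h.exists_lintegral_leafEnergy_le hlam hw1 hw hg hε (by linarith)
    (lintegral_dist_lt_top hB hH2) hr hp0 hp1 hp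
  have hmeas : ∀ n : ℕ, Measurable fun ω =>
      leafEnergy lam u₀ α ε r (n + 1) (randomLeafLaw lam hlam w B K Z (n + 1) ω) := fun n =>
    measurable_leafEnergy h hw1 hw (n + 1)
  have hfatou : ∫⁻ ω, liminf (fun n => leafEnergy lam u₀ α ε r (n + 1)
      (randomLeafLaw lam hlam w B K Z (n + 1) ω)) atTop ∂P ≠ ∞ := by
    refine ne_top_of_le_ne_top hC ((lintegral_liminf_le hmeas).trans ?_)
    refine (liminf_le_liminf (Eventually.of_forall fun n => hCn (n + 1) (by omega))).trans ?_
    simp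
  filter_upwards [ae_lt_top (Measurable.liminf hmeas) hfatou, h.ae_isGrafting hw1 hw]
    with ω hω hgraft
  obtain ⟨M, hM1, hM2⟩ := exists_between hω
  exact dimBound_le_dimH_leaves_of_leafEnergy hw1 hw hgraft hg.α_pos hε hε2 hr hM2.ne
    (frequently_lt_of_liminf_lt (h := hM1))

end Main

theorem mainTheorem5
    {U : Type*} [MetricSpace U] [CompleteSpace U] [SecondCountableTopology U]
    [MeasurableSpace U] [BorelSpace U] (u₀ : U)
    {Ω : Type*} [MeasurableSpace Ω] (P : Measure Ω) [IsProbabilityMeasure P]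
    (lam w : ℕ → ℝ) (hlam : ∀ n, 1 ≤ n → 0 < lam n)
    (hw1 : 0 < w 1) (hw : ∀ n, 1 ≤ n → 0 ≤ w n)
    (B : ℕ → Ω → Block u₀) (K : ℕ → Ω → ℕ) (Z : ℕ → Ω → U)
    (hglue : IsRandomGluing P w B K Z)
    (α β : ℝ)
    (hyp : HypCircle lam w α β ∨ (β = 1 ∧ HypSquare lam w α))
    (hH2 : ∫⁻ h, ENNReal.ofReal (h ^ 2) ∂(heightLaw P (B 1)) < ∞)
    (hH0 : 0 < heightLaw P (B 1) (Ioi 0)) :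
    ∀ᵐ ω ∂P, ENNReal.ofReal (1 / α) ≤
      dimH (leaves lam hlam (fun k => B k ω) (fun n => K n ω) (fun n => Z n ω)) := by
  have hg : GrowthBounds lam w α := by
    rcases hyp with h | ⟨-, h⟩
    exacts [h.growthBounds hw1 hw, h.growthBounds hw1 hw]
  -- A countable family of values of ε, all below 1/2 and tending to 0, gives a single almost sure
  -- event.
  have hall : ∀ᵐ ω ∂P, ∀ m : ℕ, ENNReal.ofReal (dimBound α (1 / ((m : ℝ) + 3))) ≤
      dimH (leaves lam hlam (fun k => B k ω) (fun n => K n ω) (fun n => Z n ω)) := by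
    refine ae_all_iff.2 fun m => ?_
    refine hglue.ae_dimBound_le_dimH_leaves hlam hw1 hw hg hH2 hH0 (by positivity) ?_
    have hm : (0 : ℝ) ≤ m := m.cast_nonneg
    rw [div_lt_div_iff₀ (by positivity) (by norm_num)]
    linarith
  have hlim : Tendsto (fun m : ℕ => 1 / ((m : ℝ) + 3)) atTop (𝓝 0) := by
    simp_rw [one_div]
    exact tendsto_inv_atTop_zero.comp
      (tendsto_atTop_add_const_right _ 3 tendsto_natCast_atTop_atTop)
  filter_upwards [hall] with ω hω
  exact le_of_tendsto' (ENNReal.tendsto_ofReal ((tendsto_dimBound hg.α_pos).comp hlim)) hω
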